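/- \textbf{Theorem.} Let $n\ge 3$ and $m\ge 1$ be integers, let $\varepsilon_1,\dots,\varepsilon_n\in\{1,-1\}$, and let $(\mathbb{R}^n,g)$ be the pseudo-Euclidean space with $g_{ij}=\delta_{ij}\varepsilon_i$. Let $\alpha\in\mathbb{R}^n$ with $\sum_{i=1}^n\varepsilon_i\alpha_i^2=\varepsilon_{i_0}$ for some index $i_0$, and put $\xi=\sum_{i=1}^n\alpha_ix_i$. Let $k,c_1,c_2,c_3>0$, $c\in\mathbb{R}$, $r>0$, $r\ne 1$ be real numbers. Put $$a=(n-2)k-m,\qquad b=m(2k+1)-(n-2)k^2,$$ assume $r(k+a)^2\ge (r-1)(a^2-b)$, and let $$N_\pm=\frac{r(k+a)\pm\sqrt{r^2(k+a)^2-r(r-1)(a^2-b)}}{r(r-1)} .$$ Then $N_+$ and $N_-$ are exactly the real roots of $r(r-1)N^2-2r(k+a)N+a^2-b=0$. Moreover, for each choice of the sign, $a-rN_\pm\neq 0$, and the following hold. (1) The set $\Omega_\pm=\{x\in\mathbb{R}^n : (a-rN_\pm)\xi+c>0\}$ is a (non-empty) open half-space: it is $\{\xi>-\tfrac{c}{a-rN_\pm}\}$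 if $a-rN_\pm>0$, and $\{\xi<-\tfrac{c}{a-rN_\pm}\}$ if $a-rN_\pm<0$. (2) On the set of $\xi$ with $(a-rN_\pm)\xi+c>0$, the functions $$f_\pm(\xi)=c_1[(a-rN_\pm)\xi+c]^{-\frac{1}{a-rN_\pm}},\quad h_\pm(\xi)=c_2[(a-rN_\pm)\xi+c]^{-\frac{N_\pm}{a-rN_\pm}},\quad \varphi_\pm(\xi)=c_3[(a-rN_\pm)\xi+c]^{-\frac{k}{a-rN_\pm}}$$ are smooth and positive, and $(f,h,\varphi)=(f_\pm,h_\pm,\varphi_\pm)$ solves $$\begin{cases}(n-2)fh\varphi''-rf\varphi h''-mh\varphi f''-2mh\varphi'f'-2rf\varphi'h'=0\\ \varepsilon_{i_0}[fh\varphi\varphi''-(n-1)fh(\varphi')^2+mh\varphi\varphi'f'+rf\varphi\varphi'h']=0\\ \varepsilon_{i_0}[-fh\varphi^2f''+(n-2)fh\varphi\varphi'f'-(m-1)h\varphi^2(f')^2-rf\varphi^2f'h']=0.\end{cases}$$ (3) For every $m$-dimensional Ricci-flat semi-Riemannian manifold $(F,g_F)$, the warped product $\Omega_\pm\times F$ with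 the metric $\widetilde g=\varphi_\pm(\xi)^{-2}g+f_\pm(\xi)^2g_F$ is a semi-Riemannian manifold which, with $h=h_\pm(\xi)$, is quasi-Einstein with $\rho=0$, that is, $$Ric_{\widetilde g}-\frac{r}{h}\,Hess_{\widetilde g}h=0 .$$ -/

import Mathlib

set_option maxSynthPendingDepth 3

open scoped Manifold ContDiff

noncomputable section

namespace QuasiEinstein

/-! ### Local semi-Riemannian geometry on a finite-dimensional vector space

`G : E → (E →L[ℝ] E →L[ℝ] ℝ)` is the local expression of a metric, in coordinates that take their
values in `E`. -/

section Coordinates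

variable {E : Type*} [NormedAddCommGroup E] [NormedSpace ℝ E]

/-- Christoffel symbols of the first kind:
`christoffelLower G z u v w = ½ (∂_u G(v, w) + ∂_v G(u, w) - ∂_w G(u, v))`. -/
def christoffelLower (G : E → E →L[ℝ] E →L[ℝ] ℝ) (z : E) : E →L[ℝ] E →L[ℝ] E →L[ℝ] ℝ :=
  (1 / 2 : ℝ) • (fderiv ℝ G z + (fderiv ℝ G z).flip
    - (ContinuousLinearMap.flipₗᵢ ℝ E E ℝ).toContinuousLinearEquiv.toContinuousLinearMap.comp
        (fderiv ℝ G z).flip)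

theorem christoffelLower_apply (G : E → E →L[ℝ] E →L[ℝ] ℝ) (z u v w : E) :
    christoffelLower G z u v w =
      1 / 2 * (fderiv ℝ G z u v w + fderiv ℝ G z v u w - fderiv ℝ G z w u v) := by
  simp [christoffelLower]

/-- Christoffel symbols of the second kind: `christoffel G z u v` is the vector `Γ` with
`G z Γ w = christoffelLower G z u v w` for all `w`. In these coordinates `∇_u v = Γ(u, v)` for
constant vector fields `u`, `v`. -/
def christoffel (G : E → E →L[ℝ] E →L[ℝ] ℝ) (z : E) : E →L[ℝ] E →L[ℝ] E :=
  (ContinuousLinearMap.compL ℝ E (E →L[ℝ] ℝ) E (G z).inverse).comp (christoffelLower G z)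

theorem christoffel_apply (G : E → E →L[ℝ] E →L[ℝ] ℝ) (z u v : E) :
    christoffel G z u v = (G z).inverse (christoffelLower G z u v) := rfl

/-- The linear map `u ↦ R(u, v)w`, with `R(u, v)w = ∇_u ∇_v w - ∇_v ∇_u w` for constant vector
fields `u`, `v`, `w`. -/
def curvature (G : E → E →L[ℝ] E →L[ℝ] ℝ) (z v w : E) : E →ₗ[ℝ] E where
  toFun u := fderiv ℝ (christoffel G) z u v w - fderiv ℝ (christoffel G) z v u w
    + christoffel G z u (christoffel G z v w) - christoffel G z v (christoffel G z u w)
  map_add' u u' := by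
    simp only [map_add, add_apply]; abel
  map_smul' t u := by
    simp only [map_smul, smul_apply, RingHom.id_apply, smul_add, smul_sub]

/-- The Ricci tensor `Ric(v, w) = tr (u ↦ R(u, v)w)`. -/
def ricci (G : E → E →L[ℝ] E →L[ℝ] ℝ) (z v w : E) : ℝ :=
  LinearMap.trace ℝ E (curvature G z v w)

/-- The Hessian `(∇dh)(u, v) = ∂_u ∂_v h - dh(Γ(u, v))`. -/
def hessian (G : E → E →L[ℝ] E →L[ℝ] ℝ) (h : E → ℝ) (z u v : E) : ℝ :=
  fderiv ℝ (fderiv ℝ h) z u v - fderiv ℝ h z (christoffel G z u v)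

end Coordinates

/-! ### Semi-Riemannian manifolds -/

/-- The symmetric bilinear form `B` is non-degenerate of index `ν`: the space is the direct sum of
a `ν`-dimensional subspace on which `B` is negative definite and a subspace on which `B` is
positive definite. -/
def HasIndex {V : Type*} [AddCommGroup V] [Module ℝ V] [TopologicalSpace V]
    (B : V →L[ℝ] V →L[ℝ] ℝ) (ν : ℕ) : Prop :=
  ∃ W W' : Submodule ℝ V, IsCompl W W' ∧ Module.finrank ℝ W = ν ∧
    (∀ w ∈ W, w ≠ 0 → B w w < 0) ∧ (∀ w ∈ W', w ≠ 0 → 0 < B w w)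

section Manifold

variable {E : Type*} [NormedAddCommGroup E] [NormedSpace ℝ E] {H : Type*} [TopologicalSpace H]
  (I : ModelWithCorners ℝ E H) {M : Type*} [TopologicalSpace M] [ChartedSpace H M]
  {E' : Type*} [NormedAddCommGroup E'] [NormedSpace ℝ E'] {H' : Type*} [TopologicalSpace H']
  (I' : ModelWithCorners ℝ E' H') {M' : Type*} [TopologicalSpace M'] [ChartedSpace H' M']

/-- Fields of bilinear forms on the tangent spaces of `M`, that is, `(0,2)`-tensor fields (no
regularity is required here). -/
abbrev BilinField (M : Type*) [TopologicalSpace M] [ChartedSpace H M] : Type _ :=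
  ∀ p : M, TangentSpace I p →L[ℝ] TangentSpace I p →L[ℝ] ℝ

variable {I'} in
/-- The pull-back `(Φ^* g)_p(u, v) = g_{Φ(p)}(dΦ_p u, dΦ_p v)`. -/
def pullback (Φ : M → M') (g : BilinField I' M') : BilinField I M := fun p =>
  (ContinuousLinearMap.precomp ℝ (mfderiv I I' Φ p)).comp ((g (Φ p)).comp (mfderiv I I' Φ p))

variable {I}

variable {I'} in
theorem pullback_apply (Φ : M → M') (g : BilinField I' M') (p : M) (u v : TangentSpace I p) :
    pullback I Φ g p u v = g (Φ p) (mfderiv I I' Φ p u) (mfderiv I I' Φ p v) := rfl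

/-- The expression of `g` in the chart `e`, a field of bilinear forms on the open subset
`(e.extend I).target` of `E` (for a manifold without boundary). -/
def localMetric (g : BilinField I M) (e : OpenPartialHomeomorph M H) : E → E →L[ℝ] E →L[ℝ] ℝ :=
  pullback 𝓘(ℝ, E) (e.extend I).symm g

theorem localMetric_apply (g : BilinField I M) (e : OpenPartialHomeomorph M H) (z u v : E) :
    localMetric g e z u v = g ((e.extend I).symm z)
      (mfderiv 𝓘(ℝ, E) I (e.extend I).symm z u) (mfderiv 𝓘(ℝ, E) I (e.extend I).symm z v) := rfl

/-- `g` is a semi-Riemannian metric on the manifold (without boundary) `M`: symmetric,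
non-degenerate, of constant index, with smooth components in each chart of the atlas. -/
structure IsSemiRiemannian (g : BilinField I M) : Prop where
  symm : ∀ (p : M) (u v : TangentSpace I p), g p u v = g p v u
  nondegenerate : ∀ (p : M) (u : TangentSpace I p), (∀ v, g p u v = 0) → u = 0
  index : ∃ ν : ℕ, ∀ p : M, HasIndex (g p) ν
  smooth : ∀ e ∈ atlas H M, ContDiffOn ℝ ∞ (localMetric g e) (e.extend I).target

/-- `(M, g)` is a Ricci-flat semi-Riemannian manifold. The tensor `Ric_g` vanishes if and only if
its components vanish in every chart of the atlas. -/
structure IsRicciFlat (g : BilinField I M) : Prop where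
  semiRiemannian : IsSemiRiemannian g
  ricci_eq : ∀ e ∈ atlas H M, ∀ z ∈ (e.extend I).target, ∀ u v : E,
    ricci (localMetric g e) z u v = 0

/-- `(M, g, h)` is a quasi-Einstein semi-Riemannian manifold with parameters `r` and `ρ`: the
function `h` is smooth and positive, and `Ric_g - (r / h) Hess_g h = ρ g`. -/
structure IsQuasiEinstein (g : BilinField I M) (h : M → ℝ) (r ρ : ℝ) : Prop where
  semiRiemannian : IsSemiRiemannian g
  smooth : ContMDiff I 𝓘(ℝ, ℝ) ∞ h
  pos : ∀ p, 0 < h p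
  equation : ∀ e ∈ atlas H M, ∀ z ∈ (e.extend I).target, ∀ u v : E,
    ricci (localMetric g e) z u v
      - r / h ((e.extend I).symm z) * hessian (localMetric g e) (h ∘ (e.extend I).symm) z u v
      = ρ * localMetric g e z u v

variable {I'} in
/-- The metric `g_B + f² g_F` of the warped product `B ×_f F`, on the product manifold. -/
def warpedProduct (gB : BilinField I M) (f : M → ℝ) (gF : BilinField I' M') :
    BilinField (I.prod I') (M × M') := fun p =>
  pullback (I.prod I') Prod.fst gB p + f p.1 ^ 2 • pullback (I.prod I') Prod.snd gF p

end Manifold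

/-! ### The base -/

/-- The pseudo-Euclidean metric `g_{ij} = δ_{ij} ε_i` on `ℝⁿ`. -/
def pseudoEuclidean {n : ℕ} (ε : Fin n → ℝ) : BilinField (𝓡 n) (EuclideanSpace ℝ (Fin n)) :=
  fun _ => (∑ i, ε i • ContinuousLinearMap.smulRight
    (EuclideanSpace.proj i : EuclideanSpace ℝ (Fin n) →L[ℝ] ℝ)
    (EuclideanSpace.proj i : EuclideanSpace ℝ (Fin n) →L[ℝ] ℝ) :
      EuclideanSpace ℝ (Fin n) →L[ℝ] EuclideanSpace ℝ (Fin n) →L[ℝ] ℝ)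

theorem pseudoEuclidean_apply {n : ℕ} (ε : Fin n → ℝ) (x u v : EuclideanSpace ℝ (Fin n)) :
    pseudoEuclidean ε x u v = ∑ i, ε i * (u i * v i) := by
  change (∑ i, ε i • ContinuousLinearMap.smulRight
    (EuclideanSpace.proj i : EuclideanSpace ℝ (Fin n) →L[ℝ] ℝ)
    (EuclideanSpace.proj i : EuclideanSpace ℝ (Fin n) →L[ℝ] ℝ) :
      EuclideanSpace ℝ (Fin n) →L[ℝ] EuclideanSpace ℝ (Fin n) →L[ℝ] ℝ) u v = _
  simp

/-- The linear function `ξ(x) = ∑ α_i x_i`. -/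
def xi {n : ℕ} (α : Fin n → ℝ) (x : EuclideanSpace ℝ (Fin n)) : ℝ := ∑ i, α i * x i

/-- The open set `{x ∈ ℝⁿ | q ξ(x) + c > 0}`. -/
def domain {n : ℕ} (α : Fin n → ℝ) (q c : ℝ) :
    TopologicalSpace.Opens (EuclideanSpace ℝ (Fin n)) :=
  ⟨{x | 0 < q * xi α x + c}, isOpen_lt continuous_const (by unfold xi; fun_prop)⟩

/-- The metric `φ(ξ)⁻² g` on an open subset of the pseudo-Euclidean space. -/
def conformalMetric {n : ℕ} (ε α : Fin n → ℝ) (φ : ℝ → ℝ)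
    (Ω : TopologicalSpace.Opens (EuclideanSpace ℝ (Fin n))) : BilinField (𝓡 n) Ω := fun x =>
  (1 / φ (xi α x) ^ 2) • pullback (𝓡 n) (Subtype.val : Ω → EuclideanSpace ℝ (Fin n))
    (pseudoEuclidean ε) x

/-! ### The explicit solutions -/

/-- `a = (n - 2) k - m` -/
def coeffA (n m : ℕ) (k : ℝ) : ℝ := ((n : ℝ) - 2) * k - m

/-- `b = m (2k + 1) - (n - 2) k²` -/
def coeffB (n m : ℕ) (k : ℝ) : ℝ := (m : ℝ) * (2 * k + 1) - ((n : ℝ) - 2) * k ^ 2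

/-- `N_±`, the sign `±` being `s = 1` or `s = -1`. -/
def rootN (n m : ℕ) (k r s : ℝ) : ℝ :=
  (r * (k + coeffA n m k) + s * √(r ^ 2 * (k + coeffA n m k) ^ 2
    - r * (r - 1) * (coeffA n m k ^ 2 - coeffB n m k))) / (r * (r - 1))

/-- The function `t ↦ C (q t + c) ^ (-(e / q))`. -/
def powerLaw (C q c e : ℝ) (t : ℝ) : ℝ := C * (q * t + c) ^ (-(e / q))

/-- The system of ordinary differential equations at `t` for functions `f`, `h`, `φ` of `ξ`, where
`κ = ∑ ε_i α_i²`, and `lF` is the constant Ricci curvature of the fibre. -/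
def ReducedSystem (n m : ℕ) (r κ ρ lF : ℝ) (f h φ : ℝ → ℝ) (t : ℝ) : Prop :=
  ((n : ℝ) - 2) * f t * h t * deriv (deriv φ) t - r * f t * φ t * deriv (deriv h) t
      - m * h t * φ t * deriv (deriv f) t - 2 * m * h t * deriv φ t * deriv f t
      - 2 * r * f t * deriv φ t * deriv h t = 0 ∧
  κ * (f t * h t * φ t * deriv (deriv φ) t - ((n : ℝ) - 1) * f t * h t * deriv φ t ^ 2
      + m * h t * φ t * deriv φ t * deriv f t + r * f t * φ t * deriv φ t * deriv h t)
      = ρ * f t * h t ∧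
  κ * (-(f t * h t * φ t ^ 2 * deriv (deriv f) t)
      + ((n : ℝ) - 2) * f t * h t * φ t * deriv φ t * deriv f t
      - ((m : ℝ) - 1) * h t * φ t ^ 2 * deriv f t ^ 2 - r * f t * φ t ^ 2 * deriv f t * deriv h t)
      = h t * (ρ * f t ^ 2 - lF)

end QuasiEinstein

end

noncomputable section

namespace QuasiEinstein

/-! ### Local metrics and their Christoffel symbols -/

section LocalMetric

variable {E : Type*} [NormedAddCommGroup E] [NormedSpace ℝ E]

/-! The metric depends on the base point only through the linear function `ξ`, so in a product chart
it has the form `P(ξ) B + Q(ξ) g`, with `B` a constant bilinear form, `P = φ⁻²`, `Q = f²` and `g`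
the metric of the fibre. For such a metric the Ricci tensor (`ricci_warpedMetric`) and the Hessian
of a function of `ξ` (`hessian_warpedMetric`) are, apart from the Ricci tensor of the fibre,
combinations of three forms: `ξ ⊗ ξ`, `B` and `g`. Their coefficients involve only the logarithmic
derivatives `p = φ'/φ`, `w = f'/f` and the first two derivatives of `h`.

For the explicit power laws the logarithmic derivatives of `φ`, `f`, `h` are `-k`, `-1`, `-N` times
`1 / (q t + c)`. Each coefficient of `Ric - (r / h) Hess h` is therefore a constant over `(q t +
c)²`, and the differential equations become algebraic. The coefficients of `B` and `g` both vanish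
because `q = a - r N`; the coefficient of `ξ ⊗ ξ` then vanishes because of `q² = r N² + 2 r k N +
b`, which is the quadratic equation for `N` (`sq_eq_of_quadratic`). The squared length of the
gradient of `ξ` only multiplies coefficients that are already zero. The algebra is collected in
`ricci_sub_hessian_powerLaw`.

It remains to pass to manifolds: `localMetric_warpedProduct_conformalMetric` shows that every
product chart yields this coordinate form, and `HasIndex.prod` adds the indices of base and fibre.
-/

/-- `G` is smooth, symmetric and non-degenerate near `z`. -/
structure IsLocalMetricAt (G : E → E →L[ℝ] E →L[ℝ] ℝ) (z : E) : Prop where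
  contDiffAt : ∀ᶠ z' in nhds z, ContDiffAt ℝ ∞ G z'
  symm : ∀ᶠ z' in nhds z, ∀ u v, G z' u v = G z' v u
  nondegenerate : ∀ᶠ z' in nhds z, ∀ u, (∀ v, G z' u v = 0) → u = 0

/-- Non-degeneracy is injectivity into the dual, which has the same finite dimension. -/
theorem isInvertible_of_nondegenerate [FiniteDimensional ℝ E] (β : E →L[ℝ] E →L[ℝ] ℝ)
    (h : ∀ u, (∀ v, β u v = 0) → u = 0) : β.IsInvertible := by
  have hinj : Function.Injective (β : E →ₗ[ℝ] E →L[ℝ] ℝ) := by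
    rw [← LinearMap.ker_eq_bot, LinearMap.ker_eq_bot']
    intro u hu
    exact h u fun v => DFunLike.congr_fun hu v
  have hdim : Module.finrank ℝ E = Module.finrank ℝ (E →L[ℝ] ℝ) := by
    rw [← (LinearMap.toContinuousLinearMap : (E →ₗ[ℝ] ℝ) ≃ₗ[ℝ] _).finrank_eq]
    exact (Subspace.dual_finrank_eq).symm
  refine ⟨(LinearEquiv.ofInjectiveOfFinrankEq _ hinj hdim).toContinuousLinearEquiv, ?_⟩
  rfl

/-- Allows a tensor to be differentiated with its arguments frozen, so that only scalar or vector
valued functions have to be differentiated below. -/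
theorem fderiv_apply_apply {V : Type*} [NormedAddCommGroup V] [NormedSpace ℝ V]
    {Γ : E → E →L[ℝ] E →L[ℝ] V} {z : E}
    (h : DifferentiableAt ℝ Γ z) (t u v : E) :
    fderiv ℝ (fun z' => Γ z' u v) z t = fderiv ℝ Γ z t u v := by
  have h1 : HasFDerivAt (fun z' => Γ z' u v) (((fderiv ℝ Γ z).flip u).flip v) z := by
    have := (h.hasFDerivAt.clm_apply (hasFDerivAt_const u z)).clm_apply (hasFDerivAt_const v z)
    convert! this using 1
    ext t
    simp
  rw [h1.fderiv]
  rfl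

namespace IsLocalMetricAt

variable {G : E → E →L[ℝ] E →L[ℝ] ℝ} {z : E}

/-- The conditions are imposed on a neighbourhood because the curvature differentiates the
Christoffel symbols, whose formula must hold near the point. -/
theorem eventually (h : IsLocalMetricAt G z) : ∀ᶠ z' in nhds z, IsLocalMetricAt G z' := by
  filter_upwards [h.contDiffAt.eventually_nhds, h.symm.eventually_nhds,
    h.nondegenerate.eventually_nhds] with z' h1 h2 h3
  exact ⟨h1, h2, h3⟩

theorem differentiableAt (h : IsLocalMetricAt G z) : DifferentiableAt ℝ G z :=
  h.contDiffAt.self_of_nhds.differentiableAt (by simp)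

theorem fderiv_symm (h : IsLocalMetricAt G z) (t u v : E) :
    fderiv ℝ G z t u v = fderiv ℝ G z t v u := by
  rw [← fderiv_apply_apply h.differentiableAt, ← fderiv_apply_apply h.differentiableAt]
  have : (fun z' => G z' u v) =ᶠ[nhds z] fun z' => G z' v u := by
    filter_upwards [h.symm] with z' h1 using h1 u v
  rw [this.fderiv_eq]

theorem christoffelLower_symm (h : IsLocalMetricAt G z) (u v : E) :
    christoffelLower G z u v = christoffelLower G z v u := by
  ext w
  rw [christoffelLower_apply, christoffelLower_apply, h.fderiv_symm w u v]
  ring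

theorem christoffel_symm (h : IsLocalMetricAt G z) (u v : E) :
    christoffel G z u v = christoffel G z v u := by
  rw [christoffel_apply, christoffel_apply, h.christoffelLower_symm]

variable [FiniteDimensional ℝ E]

theorem isInvertible (h : IsLocalMetricAt G z) : (G z).IsInvertible :=
  isInvertible_of_nondegenerate _ h.nondegenerate.self_of_nhds

theorem metric_christoffel (h : IsLocalMetricAt G z) (u v w : E) :
    G z (christoffel G z u v) w = christoffelLower G z u v w := by
  rw [christoffel_apply, h.isInvertible.self_apply_inverse]

/-- This is how Christoffel symbols get computed: a candidate is tested against the Koszul formula,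
and the metric never has to be inverted explicitly. -/
theorem christoffel_eq (h : IsLocalMetricAt G z) {u v Γ : E}
    (hΓ : ∀ w, G z Γ w = christoffelLower G z u v w) : christoffel G z u v = Γ := by
  have : G z Γ = christoffelLower G z u v := by ext w; exact hΓ w
  rw [christoffel_apply, ← this, h.isInvertible.inverse_apply_self]

/-- Inversion is smooth at an invertible map, and `christoffelLower` is linear in the derivative of
the metric. -/
theorem differentiableAt_christoffel (h : IsLocalMetricAt G z) :
    DifferentiableAt ℝ (christoffel G) z := by
  have : CompleteSpace E := FiniteDimensional.complete ℝ E
  have h1 : DifferentiableAt ℝ (fun z' => (G z').inverse) z := by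
    have h2 : ContDiffAt ℝ ∞ (ContinuousLinearMap.inverse : (E →L[ℝ] E →L[ℝ] ℝ) → _) (G z) :=
      h.isInvertible.contDiffAt_map_inverse
    exact (h2.comp z h.contDiffAt.self_of_nhds).differentiableAt (by simp)
  have h3 : DifferentiableAt ℝ (fderiv ℝ G) z :=
    (h.contDiffAt.self_of_nhds.fderiv_right (m := ∞) (by simp)).differentiableAt (by simp)
  have h4 : DifferentiableAt ℝ (christoffelLower G) z := by
    have h5 : DifferentiableAt ℝ (fun z' => (fderiv ℝ G z').flip) z :=
      ((ContinuousLinearMap.flipₗᵢ ℝ E E (E →L[ℝ] ℝ)).toContinuousLinearEquiv.toContinuousLinearMap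
        |>.differentiableAt).comp z h3
    unfold christoffelLower
    exact ((h3.fun_add h5).fun_sub ((differentiableAt_const _).clm_comp h5)).fun_const_smul _
  have h6 : DifferentiableAt ℝ (fun z' =>
      ContinuousLinearMap.compL ℝ E (E →L[ℝ] ℝ) E (G z').inverse) z :=
    (ContinuousLinearMap.differentiableAt _).comp z h1
  exact h6.clm_comp h4

theorem curvature_apply (h : IsLocalMetricAt G z) (u v w : E) :
    curvature G z v w u = fderiv ℝ (fun z' => christoffel G z' v w) z u
      - fderiv ℝ (fun z' => christoffel G z' u w) z v
      + christoffel G z u (christoffel G z v w) - christoffel G z v (christoffel G z u w) := by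
  rw [fderiv_apply_apply h.differentiableAt_christoffel,
    fderiv_apply_apply h.differentiableAt_christoffel]
  rfl

end IsLocalMetricAt

theorem christoffel_congr {G G' : E → E →L[ℝ] E →L[ℝ] ℝ} {z : E} (h : G =ᶠ[nhds z] G') :
    christoffel G =ᶠ[nhds z] christoffel G' := by
  filter_upwards [h, h.fderiv (𝕜 := ℝ)] with z' h1 h2
  simp only [christoffel, christoffelLower, h1, h2]

theorem ricci_congr {G G' : E → E →L[ℝ] E →L[ℝ] ℝ} {z : E} (h : G =ᶠ[nhds z] G') (v w : E) :
    ricci G z v w = ricci G' z v w := by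
  have h1 := christoffel_congr h
  unfold ricci
  congr 1
  ext u
  simp only [curvature, LinearMap.coe_mk, AddHom.coe_mk, h1.fderiv_eq, h1.self_of_nhds]

theorem hessian_congr {G G' : E → E →L[ℝ] E →L[ℝ] ℝ} {h h' : E → ℝ} {z : E}
    (hG : G =ᶠ[nhds z] G') (hh : h =ᶠ[nhds z] h') (v w : E) :
    hessian G h z v w = hessian G' h' z v w := by
  simp only [hessian, (christoffel_congr hG).self_of_nhds, hh.fderiv.fderiv_eq, hh.fderiv_eq]

end LocalMetric

/-! ### Traces -/

section Trace

variable {V W : Type*} [AddCommGroup V] [Module ℝ V] [FiniteDimensional ℝ V]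
  [AddCommGroup W] [Module ℝ W] [FiniteDimensional ℝ W]

/-- Only the diagonal blocks contribute; this splits the Ricci tensor into a sum over base
directions and a sum over fibre directions. -/
theorem trace_prod (T : V × W →ₗ[ℝ] V × W) :
    LinearMap.trace ℝ _ T = LinearMap.trace ℝ _ (.fst ℝ V W ∘ₗ T ∘ₗ .inl ℝ V W)
      + LinearMap.trace ℝ _ (.snd ℝ V W ∘ₗ T ∘ₗ .inr ℝ V W) := by
  have hT : T = (T ∘ₗ .inl ℝ V W) ∘ₗ .fst ℝ V W + (T ∘ₗ .inr ℝ V W) ∘ₗ .snd ℝ V W := by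
    ext x <;> simp [← Prod.zero_eq_mk]
  conv_lhs => rw [hT, map_add]
  rw [LinearMap.trace_comp_comm', LinearMap.trace_comp_comm' _ (LinearMap.snd ℝ V W)]

theorem trace_smulRight (l : V →ₗ[ℝ] ℝ) (x : V) :
    LinearMap.trace ℝ V (l.smulRight x) = l x := by
  have : l.smulRight x = LinearMap.toSpanSingleton ℝ V x ∘ₗ l := by ext; simp
  rw [this, LinearMap.trace_comp_comm']
  have h2 : l ∘ₗ LinearMap.toSpanSingleton ℝ V x = l x • LinearMap.id := by ext; simp
  rw [h2, map_smul, LinearMap.trace_id]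
  simp

end Trace

/-! ### Warped products with a conformally flat base, in coordinates -/

section WarpedLocal

variable {E₁ E₂ : Type*} [NormedAddCommGroup E₁] [NormedSpace ℝ E₁]
  [NormedAddCommGroup E₂] [NormedSpace ℝ E₂]

/-- The orthogonal sum of two bilinear forms. -/
def orthogonalSum (β : E₁ →L[ℝ] E₁ →L[ℝ] ℝ) (γ : E₂ →L[ℝ] E₂ →L[ℝ] ℝ) :
    E₁ × E₂ →L[ℝ] E₁ × E₂ →L[ℝ] ℝ :=
  (ContinuousLinearMap.precomp ℝ (.fst ℝ E₁ E₂)).comp (β.comp (.fst ℝ E₁ E₂))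
    + (ContinuousLinearMap.precomp ℝ (.snd ℝ E₁ E₂)).comp (γ.comp (.snd ℝ E₁ E₂))

@[simp]
theorem orthogonalSum_apply (β : E₁ →L[ℝ] E₁ →L[ℝ] ℝ) (γ : E₂ →L[ℝ] E₂ →L[ℝ] ℝ)
    (u v : E₁ × E₂) : orthogonalSum β γ u v = β u.1 v.1 + γ u.2 v.2 := rfl

/-- The metric `P(ℓ x) B + Q(ℓ x) g_y` at the point `(x, y)`. -/
def warpedMetric (ℓ : E₁ →L[ℝ] ℝ) (P Q : ℝ → ℝ) (B : E₁ →L[ℝ] E₁ →L[ℝ] ℝ)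
    (g : E₂ → E₂ →L[ℝ] E₂ →L[ℝ] ℝ) (z : E₁ × E₂) : E₁ × E₂ →L[ℝ] E₁ × E₂ →L[ℝ] ℝ :=
  orthogonalSum (P (ℓ z.1) • B) (Q (ℓ z.1) • g z.2)

/-- On the open set `T`, the functions `P` and `Q` are smooth without zeros, `P' / P = -2 p` and
`Q' / Q = 2 w`. -/
structure IsWarpData (T : Set ℝ) (P Q p w dp dw : ℝ → ℝ) : Prop where
  isOpen : IsOpen T
  contDiffAt_P : ∀ t ∈ T, ContDiffAt ℝ ∞ P t
  contDiffAt_Q : ∀ t ∈ T, ContDiffAt ℝ ∞ Q t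
  ne_zero_P : ∀ t ∈ T, P t ≠ 0
  ne_zero_Q : ∀ t ∈ T, Q t ≠ 0
  deriv_P : ∀ t ∈ T, HasDerivAt P (-(2 * p t * P t)) t
  deriv_Q : ∀ t ∈ T, HasDerivAt Q (2 * w t * Q t) t
  deriv_p : ∀ t ∈ T, HasDerivAt p (dp t) t
  deriv_w : ∀ t ∈ T, HasDerivAt w (dw t) t

/-- `B` is a symmetric non-degenerate form, and `A` is the vector dual to `ℓ`. -/
structure IsDualVector (ℓ : E₁ →L[ℝ] ℝ) (B : E₁ →L[ℝ] E₁ →L[ℝ] ℝ) (A : E₁) : Prop where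
  symm : ∀ u v, B u v = B v u
  nondegenerate : ∀ u, (∀ v, B u v = 0) → u = 0
  dual : ∀ v, B A v = ℓ v

variable {ℓ : E₁ →L[ℝ] ℝ} {P Q p w dp dw : ℝ → ℝ} {T : Set ℝ} {B : E₁ →L[ℝ] E₁ →L[ℝ] ℝ} {A : E₁}
  {g : E₂ → E₂ →L[ℝ] E₂ →L[ℝ] ℝ} {z : E₁ × E₂}

theorem contDiffAt_warpedMetric (hP : ContDiffAt ℝ ∞ P (ℓ z.1)) (hQ : ContDiffAt ℝ ∞ Q (ℓ z.1))
    (hg : ContDiffAt ℝ ∞ g z.2) : ContDiffAt ℝ ∞ (warpedMetric ℓ P Q B g) z := by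
  have hℓ : ContDiffAt ℝ ∞ (fun z : E₁ × E₂ => ℓ z.1) z := by fun_prop
  have h1 : ContDiffAt ℝ ∞ (fun z : E₁ × E₂ => P (ℓ z.1) • B) z :=
    (hP.comp z hℓ).smul contDiffAt_const
  have h2 : ContDiffAt ℝ ∞ (fun z : E₁ × E₂ => Q (ℓ z.1) • g z.2) z :=
    (hQ.comp z hℓ).smul (hg.comp z contDiffAt_snd)
  exact (contDiffAt_const.clm_comp (h1.clm_comp contDiffAt_const)).add
    (contDiffAt_const.clm_comp (h2.clm_comp contDiffAt_const))

theorem orthogonalSum_nondegenerate {β : E₁ →L[ℝ] E₁ →L[ℝ] ℝ} {γ : E₂ →L[ℝ] E₂ →L[ℝ] ℝ}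
    (hβ : ∀ u, (∀ v, β u v = 0) → u = 0) (hγ : ∀ u, (∀ v, γ u v = 0) → u = 0)
    (u : E₁ × E₂) (hu : ∀ v, orthogonalSum β γ u v = 0) : u = 0 :=
  Prod.ext (hβ _ fun v => by simpa using hu (v, 0)) (hγ _ fun v => by simpa using hu (0, v))

theorem smul_nondegenerate {β : E₁ →L[ℝ] E₁ →L[ℝ] ℝ} {t : ℝ} (ht : t ≠ 0)
    (hβ : ∀ u, (∀ v, β u v = 0) → u = 0) (u : E₁) (hu : ∀ v, (t • β) u v = 0) : u = 0 :=
  hβ u fun v => by simpa [ht] using hu v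

theorem isLocalMetricAt_warpedMetric (hW : IsWarpData T P Q p w dp dw) (hB : IsDualVector ℓ B A)
    (hg : IsLocalMetricAt g z.2) (hz : ℓ z.1 ∈ T) :
    IsLocalMetricAt (warpedMetric ℓ P Q B g) z := by
  have hev : ∀ᶠ z' in nhds z, ℓ z'.1 ∈ T ∧ IsLocalMetricAt g z'.2 :=
    ((show Continuous fun z' : E₁ × E₂ => ℓ z'.1 by fun_prop).continuousAt.eventually_mem
      (hW.isOpen.mem_nhds hz)).and (continuousAt_snd.eventually hg.eventually)
  refine ⟨?_, ?_, ?_⟩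
  · filter_upwards [hev] with z' h1
    exact contDiffAt_warpedMetric (hW.contDiffAt_P _ h1.1) (hW.contDiffAt_Q _ h1.1)
      h1.2.contDiffAt.self_of_nhds
  · filter_upwards [hev] with z' h1 u v
    simp [warpedMetric, hB.symm u.1 v.1, h1.2.symm.self_of_nhds u.2 v.2]
  · filter_upwards [hev] with z' h1
    exact orthogonalSum_nondegenerate (smul_nondegenerate (hW.ne_zero_P _ h1.1) hB.nondegenerate)
      (smul_nondegenerate (hW.ne_zero_Q _ h1.1) h1.2.nondegenerate.self_of_nhds)

theorem hasFDerivAt_comp_fst {F : ℝ → ℝ} {F' : ℝ} (hF : HasDerivAt F F' (ℓ z.1)) :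
    HasFDerivAt (fun z : E₁ × E₂ => F (ℓ z.1)) (F' • ℓ.comp (.fst ℝ E₁ E₂)) z :=
  hF.comp_hasFDerivAt z (ℓ.comp (.fst ℝ E₁ E₂)).hasFDerivAt

theorem fderiv_comp_fst {F : ℝ → ℝ} {F' : ℝ} (hF : HasDerivAt F F' (ℓ z.1)) (u : E₁ × E₂) :
    fderiv ℝ (fun z : E₁ × E₂ => F (ℓ z.1)) z u = F' * ℓ u.1 := by
  rw [(hasFDerivAt_comp_fst hF).fderiv]; simp

theorem hasFDerivAt_apply_snd (hg : DifferentiableAt ℝ g z.2) (u v : E₂) :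
    HasFDerivAt (fun z : E₁ × E₂ => g z.2 u v)
      ((((fderiv ℝ g z.2).flip u).flip v).comp (.snd ℝ E₁ E₂)) z := by
  have h1 : DifferentiableAt ℝ (fun y => g y u v) z.2 := by fun_prop
  have h2 := h1.hasFDerivAt.comp z (hasFDerivAt_snd (𝕜 := ℝ) (p := z))
  convert! h2 using 1
  ext t <;> simp [fderiv_apply_apply hg]

theorem fderiv_warpedMetric (hW : IsWarpData T P Q p w dp dw) (hB : IsDualVector ℓ B A)
    (hg : IsLocalMetricAt g z.2) (hz : ℓ z.1 ∈ T) (t u v : E₁ × E₂) :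
    fderiv ℝ (warpedMetric ℓ P Q B g) z t u v =
      -(2 * p (ℓ z.1) * P (ℓ z.1)) * ℓ t.1 * B u.1 v.1
        + (2 * w (ℓ z.1) * Q (ℓ z.1) * ℓ t.1 * g z.2 u.2 v.2
          + Q (ℓ z.1) * fderiv ℝ g z.2 t.2 u.2 v.2) := by
  rw [← fderiv_apply_apply (isLocalMetricAt_warpedMetric hW hB hg hz).differentiableAt]
  have h := ((hasFDerivAt_comp_fst (hW.deriv_P _ hz)).mul_const (B u.1 v.1)).add
    ((hasFDerivAt_comp_fst (hW.deriv_Q _ hz)).mul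
      (hasFDerivAt_apply_snd hg.differentiableAt u.2 v.2))
  have h' : HasFDerivAt (fun z' => warpedMetric ℓ P Q B g z' u v) _ z := h
  rw [h'.fderiv]
  simp
  ring

variable [FiniteDimensional ℝ E₁] [FiniteDimensional ℝ E₂]

/-- The first bracket is the Christoffel symbol of the conformally flat base. The derivative of `Q`
adds a multiple of the gradient `A`, with `Q / P` coming from raising an index by `P • B`, and the
mixed terms in the fibre component. -/
theorem christoffel_warpedMetric (hW : IsWarpData T P Q p w dp dw) (hB : IsDualVector ℓ B A)
    (hg : IsLocalMetricAt g z.2) (hz : ℓ z.1 ∈ T) (u v : E₁ × E₂) :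
    christoffel (warpedMetric ℓ P Q B g) z u v =
      (-p (ℓ z.1) • (ℓ u.1 • v.1 + ℓ v.1 • u.1 - B u.1 v.1 • A)
          - (w (ℓ z.1) * (Q (ℓ z.1) / P (ℓ z.1)) * g z.2 u.2 v.2) • A,
        christoffel g z.2 u.2 v.2 + w (ℓ z.1) • (ℓ u.1 • v.2 + ℓ v.1 • u.2)) := by
  apply (isLocalMetricAt_warpedMetric hW hB hg hz).christoffel_eq
  intro x
  have hP := hW.ne_zero_P _ hz
  rw [christoffelLower_apply]
  simp only [fderiv_warpedMetric hW hB hg hz]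
  have h1 := hg.metric_christoffel u.2 v.2 x.2
  rw [christoffelLower_apply] at h1
  simp [warpedMetric, hB.dual, h1]
  field_simp
  ring

theorem fderiv_christoffel_warpedMetric (hW : IsWarpData T P Q p w dp dw)
    (hB : IsDualVector ℓ B A) (hg : IsLocalMetricAt g z.2) (hz : ℓ z.1 ∈ T) (t u v : E₁ × E₂) :
    fderiv ℝ (fun z' => christoffel (warpedMetric ℓ P Q B g) z' u v) z t =
      (-(dp (ℓ z.1) * ℓ t.1) • (ℓ u.1 • v.1 + ℓ v.1 • u.1 - B u.1 v.1 • A)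
          - ((dw (ℓ z.1) + 2 * w (ℓ z.1) * (w (ℓ z.1) + p (ℓ z.1))) * (Q (ℓ z.1) / P (ℓ z.1))
              * ℓ t.1 * g z.2 u.2 v.2
            + w (ℓ z.1) * (Q (ℓ z.1) / P (ℓ z.1)) * fderiv ℝ g z.2 t.2 u.2 v.2) • A,
        fderiv ℝ (christoffel g) z.2 t.2 u.2 v.2
          + (dw (ℓ z.1) * ℓ t.1) • (ℓ u.1 • v.2 + ℓ v.1 • u.2)) := by
  have hev : (fun z' => christoffel (warpedMetric ℓ P Q B g) z' u v) =ᶠ[nhds z] fun z' =>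
      (-p (ℓ z'.1) • (ℓ u.1 • v.1 + ℓ v.1 • u.1 - B u.1 v.1 • A)
          - (w (ℓ z'.1) * (Q (ℓ z'.1) / P (ℓ z'.1)) * g z'.2 u.2 v.2) • A,
        christoffel g z'.2 u.2 v.2 + w (ℓ z'.1) • (ℓ u.1 • v.2 + ℓ v.1 • u.2)) := by
    filter_upwards [(show Continuous fun z' : E₁ × E₂ => ℓ z'.1 by fun_prop).continuousAt.eventually_mem
      (hW.isOpen.mem_nhds hz),
      continuousAt_snd.eventually hg.eventually] with z' h1 h2
    exact christoffel_warpedMetric hW hB h2 h1 u v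
  rw [hev.fderiv_eq]
  have hP := hW.ne_zero_P _ hz
  have hp := hasFDerivAt_comp_fst (E₂ := E₂) (hW.deriv_p _ hz)
  -- The logarithmic derivative of `Q / P` is `2 w + 2 p`.
  have hS : HasDerivAt (fun t => w t * (Q t / P t)) ((dw (ℓ z.1)
      + 2 * w (ℓ z.1) * (w (ℓ z.1) + p (ℓ z.1))) * (Q (ℓ z.1) / P (ℓ z.1))) (ℓ z.1) := by
    convert! (hW.deriv_w _ hz).fun_mul ((hW.deriv_Q _ hz).fun_div (hW.deriv_P _ hz) hP) using 1
    field_simp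
    ring
  have h1 := (hp.fun_neg.smul_const (ℓ u.1 • v.1 + ℓ v.1 • u.1 - B u.1 v.1 • A)).fun_sub
    (((hasFDerivAt_comp_fst (E₂ := E₂) hS).fun_mul
      (hasFDerivAt_apply_snd hg.differentiableAt u.2 v.2)).smul_const A)
  have h2 : HasFDerivAt (fun z' : E₁ × E₂ => christoffel g z'.2 u.2 v.2)
      ((((fderiv ℝ (christoffel g) z.2).flip u.2).flip v.2).comp (.snd ℝ E₁ E₂)) z := by
    have hc := hg.differentiableAt_christoffel
    have h1 : DifferentiableAt ℝ (fun y => christoffel g y u.2 v.2) z.2 := by fun_prop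
    have h2 := h1.hasFDerivAt.comp z (hasFDerivAt_snd (𝕜 := ℝ) (p := z))
    convert! h2 using 1
    ext t <;> simp [fderiv_apply_apply hc]
  have h3 := h2.fun_add ((hasFDerivAt_comp_fst (E₂ := E₂) (hW.deriv_w _ hz)).smul_const
    (ℓ u.1 • v.2 + ℓ v.1 • u.2))
  rw [(h1.prodMk h3).fderiv]
  refine Prod.ext ?_ ?_
  · simp
    module
  · simp

end WarpedLocal

/-! ### Ricci tensor and Hessian of the warped metric. -/

section WarpedRicci

variable {E₁ E₂ : Type*} [NormedAddCommGroup E₁] [NormedSpace ℝ E₁]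
  [NormedAddCommGroup E₂] [NormedSpace ℝ E₂] [FiniteDimensional ℝ E₁] [FiniteDimensional ℝ E₂]
  {ℓ : E₁ →L[ℝ] ℝ} {P Q p w dp dw : ℝ → ℝ} {T : Set ℝ} {B : E₁ →L[ℝ] E₁ →L[ℝ] ℝ} {A : E₁}
  {g : E₂ → E₂ →L[ℝ] E₂ →L[ℝ] ℝ} {z : E₁ × E₂}

theorem trace_curvature_base (hW : IsWarpData T P Q p w dp dw) (hB : IsDualVector ℓ B A)
    (hg : IsLocalMetricAt g z.2) (hz : ℓ z.1 ∈ T) (v y : E₁ × E₂) :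
    LinearMap.trace ℝ _ (.fst ℝ E₁ E₂ ∘ₗ curvature (warpedMetric ℓ P Q B g) z v y ∘ₗ .inl ℝ E₁ E₂) =
      ((Module.finrank ℝ E₁ : ℝ) - 2) * (dp (ℓ z.1) + p (ℓ z.1) ^ 2) * ℓ v.1 * ℓ y.1
      + (dp (ℓ z.1) - ((Module.finrank ℝ E₁ : ℝ) - 2) * p (ℓ z.1) ^ 2) * ℓ A * B v.1 y.1
      - (dw (ℓ z.1) + w (ℓ z.1) ^ 2 - ((Module.finrank ℝ E₁ : ℝ) - 2) * p (ℓ z.1) * w (ℓ z.1))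
        * (Q (ℓ z.1) / P (ℓ z.1)) * ℓ A * g z.2 v.2 y.2 := by
  have hL := isLocalMetricAt_warpedMetric hW hB hg hz
  have hf := fderiv_christoffel_warpedMetric hW hB hg hz
  have hc := christoffel_warpedMetric hW hB hg hz
  set p₀ := p (ℓ z.1)
  set w₀ := w (ℓ z.1)
  set S := Q (ℓ z.1) / P (ℓ z.1)
  set dp₀ := dp (ℓ z.1)
  set dw₀ := dw (ℓ z.1)
  set γ := g z.2 v.2 y.2
  -- `Γ` is the base component of `∇_v y`; it stays opaque until the traces are taken, since only
  -- its linearity matters before.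
  obtain ⟨Γ, hΓ⟩ : ∃ Γ : E₁, Γ = -p₀ • (ℓ v.1 • y.1 + ℓ y.1 • v.1 - B v.1 y.1 • A)
    - (w₀ * S * γ) • A := ⟨_, rfl⟩
  have hvy : christoffel (warpedMetric ℓ P Q B g) z v y =
      (Γ, christoffel g z.2 v.2 y.2 + w₀ • (ℓ v.1 • y.2 + ℓ y.1 • v.2)) := by
    rw [hΓ]; exact hc v y
  -- The block is a multiple of the identity plus rank-one maps, whose traces are read off by
  -- evaluating the functional at the vector.
  have key : (LinearMap.fst ℝ E₁ E₂ ∘ₗ curvature (warpedMetric ℓ P Q B g) z v y ∘ₗ .inl ℝ E₁ E₂) =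
      (ℓ : E₁ →ₗ[ℝ] ℝ).smulRight ((-dp₀ - 2 * p₀ ^ 2) • ℓ y.1 • v.1
          + ((dp₀ + p₀ ^ 2) * B v.1 y.1) • A - ((dw₀ + w₀ ^ 2 + 2 * w₀ * p₀) * S * γ) • A
          - p₀ • Γ - (p₀ ^ 2 * ℓ v.1) • y.1)
        + ((dp₀ - p₀ ^ 2) * ℓ v.1 * ℓ y.1 - p₀ * ℓ Γ) • LinearMap.id
        + (B (-(dp₀ * ℓ v.1) • y.1 + p₀ • Γ + (p₀ ^ 2 * ℓ y.1) • v.1) : E₁ →ₗ[ℝ] ℝ).smulRight A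
        + (B y.1 : E₁ →ₗ[ℝ] ℝ).smulRight ((p₀ ^ 2 * ℓ A) • v.1) := by
    ext u
    have hA : B v.1 A = ℓ v.1 := by rw [hB.symm, hB.dual]
    simp only [LinearMap.comp_apply, LinearMap.fst_apply, LinearMap.inl_apply, hL.curvature_apply,
      hvy]
    simp only [hf, hc]
    simp [hB.symm u y.1, hB.symm u Γ, hA]
    module
  rw [key]
  simp only [map_add, map_smul, trace_smulRight, LinearMap.trace_id]
  simp [hΓ, hB.dual, hB.symm _ A]
  rw [hB.symm y.1 v.1]
  ring

theorem trace_curvature_fibre (hW : IsWarpData T P Q p w dp dw) (hB : IsDualVector ℓ B A)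
    (hg : IsLocalMetricAt g z.2) (hz : ℓ z.1 ∈ T) (v y : E₁ × E₂) :
    LinearMap.trace ℝ _ (.snd ℝ E₁ E₂ ∘ₗ curvature (warpedMetric ℓ P Q B g) z v y ∘ₗ .inr ℝ E₁ E₂) =
      ricci g z.2 v.2 y.2
      - (Module.finrank ℝ E₂ : ℝ) * (dw (ℓ z.1) + w (ℓ z.1) ^ 2 + 2 * p (ℓ z.1) * w (ℓ z.1))
        * ℓ v.1 * ℓ y.1
      + (Module.finrank ℝ E₂ : ℝ) * p (ℓ z.1) * w (ℓ z.1) * ℓ A * B v.1 y.1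
      - ((Module.finrank ℝ E₂ : ℝ) - 1) * w (ℓ z.1) ^ 2
        * (Q (ℓ z.1) / P (ℓ z.1)) * ℓ A * g z.2 v.2 y.2 := by
  have hL := isLocalMetricAt_warpedMetric hW hB hg hz
  have hf := fderiv_christoffel_warpedMetric hW hB hg hz
  have hc := christoffel_warpedMetric hW hB hg hz
  set p₀ := p (ℓ z.1)
  set w₀ := w (ℓ z.1)
  set S := Q (ℓ z.1) / P (ℓ z.1)
  set dp₀ := dp (ℓ z.1)
  set dw₀ := dw (ℓ z.1)
  set γ := g z.2 v.2 y.2 with hγ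
  obtain ⟨Γ, hΓ⟩ : ∃ Γ : E₁, Γ = -p₀ • (ℓ v.1 • y.1 + ℓ y.1 • v.1 - B v.1 y.1 • A)
    - (w₀ * S * γ) • A := ⟨_, rfl⟩
  have hvy : christoffel (warpedMetric ℓ P Q B g) z v y =
      (Γ, christoffel g z.2 v.2 y.2 + w₀ • (ℓ v.1 • y.2 + ℓ y.1 • v.2)) := by
    rw [hΓ]; exact hc v y
  -- Same pattern, with the curvature of the fibre added. The rank-one term is what turns `finrank`
  -- into `finrank - 1` in the coefficient of `w ^ 2`.
  have key : (LinearMap.snd ℝ E₁ E₂ ∘ₗ curvature (warpedMetric ℓ P Q B g) z v y ∘ₗ .inr ℝ E₁ E₂) =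
      curvature g z.2 v.2 y.2 + (w₀ * ℓ Γ - (dw₀ + w₀ ^ 2) * ℓ v.1 * ℓ y.1) • LinearMap.id
        + (g z.2 y.2 : E₂ →ₗ[ℝ] ℝ).smulRight ((w₀ ^ 2 * S * ℓ A) • v.2) := by
    ext u
    simp only [LinearMap.comp_apply, LinearMap.snd_apply, LinearMap.inr_apply, hL.curvature_apply,
      hvy]
    simp only [hf, hc]
    simp [hg.symm.self_of_nhds u y.2, hg.christoffel_symm v.2 u, curvature]
    module
  rw [key]
  simp only [map_add, map_smul, trace_smulRight, LinearMap.trace_id, ricci]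
  simp [hΓ, hg.symm.self_of_nhds y.2 v.2, ← hγ]
  ring

/-- The Ricci tensor of the warped product of a conformally flat base and a fibre `g`. -/
theorem ricci_warpedMetric (hW : IsWarpData T P Q p w dp dw) (hB : IsDualVector ℓ B A)
    (hg : IsLocalMetricAt g z.2) (hz : ℓ z.1 ∈ T) (v y : E₁ × E₂) :
    ricci (warpedMetric ℓ P Q B g) z v y =
      ricci g z.2 v.2 y.2
      + (((Module.finrank ℝ E₁ : ℝ) - 2) * (dp (ℓ z.1) + p (ℓ z.1) ^ 2)
        - (Module.finrank ℝ E₂ : ℝ) * (dw (ℓ z.1) + w (ℓ z.1) ^ 2 + 2 * p (ℓ z.1) * w (ℓ z.1)))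
        * ℓ v.1 * ℓ y.1
      + (dp (ℓ z.1) - ((Module.finrank ℝ E₁ : ℝ) - 2) * p (ℓ z.1) ^ 2
        + (Module.finrank ℝ E₂ : ℝ) * p (ℓ z.1) * w (ℓ z.1)) * ℓ A * B v.1 y.1
      - (dw (ℓ z.1) + (Module.finrank ℝ E₂ : ℝ) * w (ℓ z.1) ^ 2
        - ((Module.finrank ℝ E₁ : ℝ) - 2) * p (ℓ z.1) * w (ℓ z.1))
        * (Q (ℓ z.1) / P (ℓ z.1)) * ℓ A * g z.2 v.2 y.2 := by
  rw [ricci, trace_prod, trace_curvature_base hW hB hg hz, trace_curvature_fibre hW hB hg hz]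
  ring

/-- The Hessian of a function of `ℓ` with respect to the metric of a warped product. -/
theorem hessian_warpedMetric (hW : IsWarpData T P Q p w dp dw) (hB : IsDualVector ℓ B A)
    (hg : IsLocalMetricAt g z.2) (hz : ℓ z.1 ∈ T) {F F' F'' : ℝ → ℝ}
    (hF : ∀ t ∈ T, HasDerivAt F (F' t) t) (hF' : ∀ t ∈ T, HasDerivAt F' (F'' t) t)
    (v y : E₁ × E₂) :
    hessian (warpedMetric ℓ P Q B g) (fun z => F (ℓ z.1)) z v y =
      (F'' (ℓ z.1) + 2 * p (ℓ z.1) * F' (ℓ z.1)) * ℓ v.1 * ℓ y.1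
      - p (ℓ z.1) * F' (ℓ z.1) * ℓ A * B v.1 y.1
      + w (ℓ z.1) * F' (ℓ z.1) * (Q (ℓ z.1) / P (ℓ z.1)) * ℓ A * g z.2 v.2 y.2 := by
  -- The first derivative is needed as an identity near `z`, because it is differentiated again.
  have hev : fderiv ℝ (fun z : E₁ × E₂ => F (ℓ z.1)) =ᶠ[nhds z]
      fun z => F' (ℓ z.1) • ℓ.comp (.fst ℝ E₁ E₂) := by
    filter_upwards [(show Continuous fun z' : E₁ × E₂ => ℓ z'.1 by
      fun_prop).continuousAt.eventually_mem (hW.isOpen.mem_nhds hz)] with z' h1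
    exact (hasFDerivAt_comp_fst (hF _ h1)).fderiv
  rw [hessian, hev.fderiv_eq, fderiv_comp_fst (hF _ hz),
    ((hasFDerivAt_comp_fst (hF' _ hz)).smul_const _).fderiv, christoffel_warpedMetric hW hB hg hz]
  simp
  ring

end WarpedRicci

/-! ### The quadratic equation and the explicit solutions -/

section Solutions

variable {n m : ℕ} {k r c q N : ℝ}

theorem quadratic_iff_rootN (hr : 0 < r) (hr1 : r ≠ 1)
    (hdisc : (r - 1) * (coeffA n m k ^ 2 - coeffB n m k) ≤ r * (k + coeffA n m k) ^ 2) (N : ℝ) :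
    r * (r - 1) * N ^ 2 - 2 * r * (k + coeffA n m k) * N + coeffA n m k ^ 2 - coeffB n m k = 0 ↔
      N = rootN n m k r 1 ∨ N = rootN n m k r (-1) := by
  unfold rootN
  set a := coeffA n m k
  set b := coeffB n m k
  have hne : r * (r - 1) ≠ 0 := mul_ne_zero hr.ne' (sub_ne_zero.2 hr1)
  have hD : 0 ≤ r ^ 2 * (k + a) ^ 2 - r * (r - 1) * (a ^ 2 - b) := by
    have := mul_le_mul_of_nonneg_left hdisc hr.le
    nlinarith
  have hs := Real.sq_sqrt hD
  set D := √(r ^ 2 * (k + a) ^ 2 - r * (r - 1) * (a ^ 2 - b))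
  -- Multiplication by the nonzero leading coefficient makes the quadratic a difference of squares,
  -- which factors without division.
  rw [eq_div_iff hne, eq_div_iff hne, ← mul_right_inj' hne,
    show r * (r - 1) * (r * (r - 1) * N ^ 2 - 2 * r * (k + a) * N + a ^ 2 - b) =
      (N * (r * (r - 1)) - (r * (k + a) + 1 * D)) * (N * (r * (r - 1)) - (r * (k + a) + -1 * D)) by
      linear_combination hs, mul_zero, mul_eq_zero, sub_eq_zero, sub_eq_zero]

/-- In terms of `q = a - r N`, the quadratic equation for `N` reads `q² = r N² + 2 r k N + b`. -/
theorem sq_eq_of_quadratic (hq : q = coeffA n m k - r * N)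
    (hN : r * (r - 1) * N ^ 2 - 2 * r * (k + coeffA n m k) * N
      + coeffA n m k ^ 2 - coeffB n m k = 0) :
    q ^ 2 = r * N ^ 2 + 2 * r * k * N + coeffB n m k := by
  rw [hq]
  linear_combination hN

/-- If `q = 0`, then `r N = a` and the identity for `q²` reads `0 = r N² + 2 k a + b`, whereas `2 k
a + b = (n - 2) k² + m` is positive. -/
theorem ne_zero_of_quadratic (hn : 3 ≤ n) (hk : 0 < k) (hr : 0 < r)
    (hq : q = coeffA n m k - r * N)
    (hN : r * (r - 1) * N ^ 2 - 2 * r * (k + coeffA n m k) * N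
      + coeffA n m k ^ 2 - coeffB n m k = 0) : q ≠ 0 := by
  intro h0
  have h1 := sq_eq_of_quadratic hq hN
  have hn' : (3 : ℝ) ≤ n := by exact_mod_cast hn
  have hm : (0 : ℝ) ≤ m := m.cast_nonneg
  have h2 : r * N = coeffA n m k := by linarith
  have h3 : 0 ≤ r * N ^ 2 := by positivity
  have h4 : 0 < ((n : ℝ) - 2) * k ^ 2 := mul_pos (by linarith) (by positivity)
  have h5 : 2 * r * k * N = 2 * k * coeffA n m k := by rw [← h2]; ring
  rw [h0, h5] at h1
  simp only [coeffA, coeffB] at h1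
  nlinarith

theorem powerLaw_pos {C e t : ℝ} (hC : 0 < C) (ht : 0 < q * t + c) : 0 < powerLaw C q c e t :=
  mul_pos hC (Real.rpow_pos_of_pos ht _)

theorem contDiffAt_powerLaw (C e : ℝ) {t : ℝ} (ht : 0 < q * t + c) :
    ContDiffAt ℝ ∞ (powerLaw C q c e) t := by
  have h : ContDiffAt ℝ ∞ (fun t => q * t + c) t := by fun_prop
  exact contDiffAt_const.mul (h.rpow_const_of_ne ht.ne')

theorem hasDerivAt_powerLaw (hq : q ≠ 0) (C e : ℝ) {t : ℝ} (ht : 0 < q * t + c) :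
    HasDerivAt (powerLaw C q c e) (-e / (q * t + c) * powerLaw C q c e t) t := by
  have h : HasDerivAt (fun t => q * t + c) q t := by
    simpa using ((hasDerivAt_id t).const_mul q).add_const c
  convert! (h.rpow_const (p := -(e / q)) (Or.inl ht.ne')).const_mul C using 1
  rw [powerLaw, Real.rpow_sub_one ht.ne']
  field_simp

theorem hasDerivAt_neg_div (e : ℝ) {t : ℝ} (ht : 0 < q * t + c) :
    HasDerivAt (fun t => -e / (q * t + c)) (e * q / (q * t + c) ^ 2) t := by
  have h : HasDerivAt (fun t => q * t + c) q t := by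
    simpa using ((hasDerivAt_id t).const_mul q).add_const c
  convert! (hasDerivAt_const t (-e)).fun_div h ht.ne' using 1
  ring

theorem hasDerivAt_deriv_powerLaw (hq : q ≠ 0) (C e : ℝ) {t : ℝ} (ht : 0 < q * t + c) :
    HasDerivAt (fun t => -e / (q * t + c) * powerLaw C q c e t)
      (e * (e + q) / (q * t + c) ^ 2 * powerLaw C q c e t) t := by
  convert! (hasDerivAt_neg_div e ht).fun_mul (hasDerivAt_powerLaw hq C e ht) using 1
  field_simp
  ring

theorem isOpen_halfLine (q c : ℝ) : IsOpen {t : ℝ | 0 < q * t + c} :=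
  isOpen_lt continuous_const (by fun_prop)

theorem deriv_deriv_powerLaw (hq : q ≠ 0) (C e : ℝ) {t : ℝ} (ht : 0 < q * t + c) :
    deriv (deriv (powerLaw C q c e)) t = e * (e + q) / (q * t + c) ^ 2 * powerLaw C q c e t := by
  have h : deriv (powerLaw C q c e) =ᶠ[nhds t] fun t => -e / (q * t + c) * powerLaw C q c e t := by
    filter_upwards [(isOpen_halfLine q c).mem_nhds ht] with s hs
      using (hasDerivAt_powerLaw hq C e hs).deriv
  rw [h.deriv_eq, (hasDerivAt_deriv_powerLaw hq C e ht).deriv]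

/-- The common factor of the functions over `(q t + c)²` comes out of each equation. The last two
reduce to `q = a - r N`, and the first to `q² = r N² + 2 r k N + b` corrected by `q` times that
relation. -/
theorem reducedSystem_powerLaw (hq : q = coeffA n m k - r * N) (hq0 : q ≠ 0)
    (hN : r * (r - 1) * N ^ 2 - 2 * r * (k + coeffA n m k) * N
      + coeffA n m k ^ 2 - coeffB n m k = 0) (κ c₁ c₂ c₃ : ℝ) {t : ℝ} (ht : 0 < q * t + c) :
    ReducedSystem n m r κ 0 0 (powerLaw c₁ q c 1) (powerLaw c₂ q c N) (powerLaw c₃ q c k) t := by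
  have h1 := sq_eq_of_quadratic hq hN
  simp only [ReducedSystem, deriv_deriv_powerLaw hq0 _ _ ht, (hasDerivAt_powerLaw hq0 _ _ ht).deriv]
  simp only [coeffA, coeffB] at h1 hq
  set f := powerLaw c₁ q c 1 t
  set h := powerLaw c₂ q c N t
  set φ := powerLaw c₃ q c k t
  refine ⟨?_, ?_, ?_⟩
  · field_simp
    linear_combination f * h * φ * (h1 - q * hq)
  · field_simp
    linear_combination κ * f * h * φ ^ 2 * k * hq
  · field_simp
    linear_combination -κ * f ^ 2 * h * φ ^ 2 * hq

/-- Here `p` and `w` are the logarithmic derivatives of `φ` and `f`, as `P = φ⁻²` and `Q = f²`. -/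
theorem isWarpData_powerLaw {c₁ c₃ : ℝ} (hc₁ : 0 < c₁) (hc₃ : 0 < c₃) (hq : q ≠ 0) (c k : ℝ) :
    IsWarpData {t | 0 < q * t + c} (fun t => 1 / powerLaw c₃ q c k t ^ 2)
      (fun t => powerLaw c₁ q c 1 t ^ 2) (fun t => -k / (q * t + c)) (fun t => -1 / (q * t + c))
      (fun t => k * q / (q * t + c) ^ 2) (fun t => 1 * q / (q * t + c) ^ 2) where
  isOpen := isOpen_halfLine q c
  contDiffAt_P t ht := contDiffAt_const.div ((contDiffAt_powerLaw c₃ k ht).pow 2)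
    (pow_pos (powerLaw_pos hc₃ ht) 2).ne'
  contDiffAt_Q t ht := (contDiffAt_powerLaw c₁ 1 ht).pow 2
  ne_zero_P t ht := (div_pos one_pos (pow_pos (powerLaw_pos hc₃ ht) 2)).ne'
  ne_zero_Q t ht := (pow_pos (powerLaw_pos hc₁ ht) 2).ne'
  deriv_P t ht := by
    have h0 := (powerLaw_pos (e := k) hc₃ ht).ne'
    convert! (hasDerivAt_const t (1 : ℝ)).fun_div ((hasDerivAt_powerLaw hq c₃ k ht).fun_pow 2)
      (pow_ne_zero 2 h0) using 1
    field_simp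
    ring
  deriv_Q t ht := by
    convert! (hasDerivAt_powerLaw hq c₁ 1 ht).fun_pow 2 using 1
    ring
  deriv_p t ht := hasDerivAt_neg_div k ht
  deriv_w t ht := hasDerivAt_neg_div 1 ht

/-- The coordinate form of `Ric - (r / h) Hess h = 0` for the explicit solutions. -/
theorem ricci_sub_hessian_powerLaw {E₁ E₂ : Type*} [NormedAddCommGroup E₁] [NormedSpace ℝ E₁]
    [NormedAddCommGroup E₂] [NormedSpace ℝ E₂] [FiniteDimensional ℝ E₁] [FiniteDimensional ℝ E₂]
    {ℓ : E₁ →L[ℝ] ℝ} {B : E₁ →L[ℝ] E₁ →L[ℝ] ℝ} {A : E₁} {g : E₂ → E₂ →L[ℝ] E₂ →L[ℝ] ℝ}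
    {z : E₁ × E₂} (hdim₁ : Module.finrank ℝ E₁ = n) (hdim₂ : Module.finrank ℝ E₂ = m)
    (hq : q = coeffA n m k - r * N) (hq0 : q ≠ 0)
    (hN : r * (r - 1) * N ^ 2 - 2 * r * (k + coeffA n m k) * N
      + coeffA n m k ^ 2 - coeffB n m k = 0)
    {c₁ c₂ c₃ : ℝ} (hc₁ : 0 < c₁) (hc₂ : 0 < c₂) (hc₃ : 0 < c₃)
    (hB : IsDualVector ℓ B A) (hg : IsLocalMetricAt g z.2)
    (hflat : ∀ v y, ricci g z.2 v y = 0) (hz : 0 < q * ℓ z.1 + c) (v y : E₁ × E₂) :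
    ricci (warpedMetric ℓ (fun t => 1 / powerLaw c₃ q c k t ^ 2)
        (fun t => powerLaw c₁ q c 1 t ^ 2) B g) z v y
      - r / powerLaw c₂ q c N (ℓ z.1) * hessian (warpedMetric ℓ
        (fun t => 1 / powerLaw c₃ q c k t ^ 2) (fun t => powerLaw c₁ q c 1 t ^ 2) B g)
        (fun z => powerLaw c₂ q c N (ℓ z.1)) z v y = 0 := by
  have hW := isWarpData_powerLaw hc₁ hc₃ hq0 c k
  rw [ricci_warpedMetric hW hB hg hz, hflat, hessian_warpedMetric hW hB hg hz
    (fun t ht => hasDerivAt_powerLaw hq0 c₂ N ht)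
    (fun t ht => hasDerivAt_deriv_powerLaw hq0 c₂ N ht), hdim₁, hdim₂]
  have h1 := sq_eq_of_quadratic hq hN
  simp only [coeffA, coeffB] at h1 hq
  have hh := (powerLaw_pos (e := N) hc₂ hz).ne'
  generalize powerLaw c₂ q c N (ℓ z.1) = h at *
  generalize powerLaw c₁ q c 1 (ℓ z.1) ^ 2 / (1 / powerLaw c₃ q c k (ℓ z.1) ^ 2) = S
  generalize g z.2 v.2 y.2 = γ
  field_simp
  -- One summand for each of the forms `ℓ ⊗ ℓ`, `B` and `g`.
  linear_combination (h1 - q * hq) * ℓ v.1 * ℓ y.1 + k * hq * ℓ A * B v.1 y.1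
    - hq * S * ℓ A * γ

end Solutions

/-! ### The index of a symmetric bilinear form -/

section Index

variable {V W : Type*} [AddCommGroup V] [Module ℝ V] [TopologicalSpace V]
  [AddCommGroup W] [Module ℝ W] [TopologicalSpace W]

theorem HasIndex.of_equiv {β : W →L[ℝ] W →L[ℝ] ℝ} {ν : ℕ} (h : HasIndex β ν)
    {β' : V →L[ℝ] V →L[ℝ] ℝ} (L : V ≃ₗ[ℝ] W) (hL : ∀ u v, β' u v = β (L u) (L v)) :
    HasIndex β' ν := by
  obtain ⟨X, Y, hc, hd, hX, hY⟩ := h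
  refine ⟨X.map L.symm.toLinearMap, Y.map L.symm.toLinearMap,
    (Submodule.orderIsoMapComap L.symm).isCompl_iff.1 hc, ?_, ?_, ?_⟩
  · rw [← hd]
    exact L.symm.finrank_map_eq X
  · rintro _ ⟨x, hx, rfl⟩ h0
    rw [hL]
    simpa using hX x hx (by rintro rfl; simp at h0)
  · rintro _ ⟨x, hx, rfl⟩ h0
    rw [hL]
    simpa using hY x hx (by rintro rfl; simp at h0)

theorem HasIndex.smul {β : V →L[ℝ] V →L[ℝ] ℝ} {ν : ℕ} (h : HasIndex β ν)
    {β' : V →L[ℝ] V →L[ℝ] ℝ} {t : ℝ} (ht : 0 < t) (hβ : ∀ u v, β' u v = t * β u v) :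
    HasIndex β' ν := by
  obtain ⟨X, Y, hc, hd, hX, hY⟩ := h
  refine ⟨X, Y, hc, hd, fun w hw h0 => ?_, fun w hw h0 => ?_⟩
  · rw [hβ]
    exact mul_neg_of_pos_of_neg ht (hX w hw h0)
  · rw [hβ]
    exact mul_pos ht (hY w hw h0)

/-- The equivalence between a product of submodules and the product of the underlying modules. -/
def prodSubmoduleEquiv (X : Submodule ℝ V) (Y : Submodule ℝ W) : X.prod Y ≃ₗ[ℝ] X × Y where
  toFun w := (⟨w.1.1, w.2.1⟩, ⟨w.1.2, w.2.2⟩)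
  invFun w := ⟨(w.1.1, w.2.1), w.1.2, w.2.2⟩
  map_add' _ _ := rfl
  map_smul' _ _ := rfl
  left_inv _ := rfl
  right_inv _ := rfl

theorem HasIndex.prod [FiniteDimensional ℝ V] [FiniteDimensional ℝ W]
    {β : V →L[ℝ] V →L[ℝ] ℝ} {γ : W →L[ℝ] W →L[ℝ] ℝ} {ν μ : ℕ}
    (hβ : HasIndex β ν) (hγ : HasIndex γ μ) {δ : V × W →L[ℝ] V × W →L[ℝ] ℝ}
    (hδ : ∀ u v, δ u v = β u.1 v.1 + γ u.2 v.2) : HasIndex δ (ν + μ) := by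
  obtain ⟨X, Y, hc, hd, hX, hY⟩ := hβ
  obtain ⟨X', Y', hc', hd', hX', hY'⟩ := hγ
  refine ⟨X.prod X', Y.prod Y', ⟨?_, ?_⟩, ?_, ?_, ?_⟩
  · rw [disjoint_iff, Submodule.prod_inf_prod, hc.inf_eq_bot, hc'.inf_eq_bot, Submodule.prod_bot]
  · rw [codisjoint_iff, Submodule.prod_sup_prod, hc.sup_eq_top, hc'.sup_eq_top, Submodule.prod_top]
  · rw [(prodSubmoduleEquiv X X').finrank_eq, Module.finrank_prod, hd, hd']
  · rintro ⟨x, y⟩ ⟨hx, hy⟩ h0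
    rw [hδ]
    -- A nonzero pair may have one zero component, where strict definiteness says nothing.
    by_cases h1 : x = 0
    · have h2 : y ≠ 0 := by rintro rfl; exact h0 (by rw [h1]; rfl)
      simpa [h1] using hX' y hy h2
    · by_cases h2 : y = 0
      · simpa [h2] using hX x hx h1
      · exact add_neg (hX x hx h1) (hX' y hy h2)
  · rintro ⟨x, y⟩ ⟨hx, hy⟩ h0
    rw [hδ]
    by_cases h1 : x = 0
    · have h2 : y ≠ 0 := by rintro rfl; exact h0 (by rw [h1]; rfl)
      simpa [h1] using hY' y hy h2
    · by_cases h2 : y = 0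
      · simpa [h2] using hY x hx h1
      · exact add_pos (hY x hx h1) (hY' y hy h2)

end Index

/-! ### Metrics in charts -/

section ProductCharts

variable {E : Type*} [NormedAddCommGroup E] [NormedSpace ℝ E] {H : Type*} [TopologicalSpace H]
  {I : ModelWithCorners ℝ E H} {M : Type*} [TopologicalSpace M]
  {E' : Type*} [NormedAddCommGroup E'] [NormedSpace ℝ E'] {H' : Type*} [TopologicalSpace H']
  {I' : ModelWithCorners ℝ E' H'} {M' : Type*} [TopologicalSpace M']

theorem extend_prod_target (e : OpenPartialHomeomorph M H) (e' : OpenPartialHomeomorph M' H') :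
    ((e.prod e').extend (I.prod I')).target = (e.extend I).target ×ˢ (e'.extend I').target := by
  rw [OpenPartialHomeomorph.extend_prod]
  rfl

variable [ChartedSpace H M] [ChartedSpace H' M']

theorem warpedProduct_apply (gB : BilinField I M) (f : M → ℝ) (gF : BilinField I' M') (p : M × M')
    (u v : TangentSpace (I.prod I') p) :
    warpedProduct gB f gF p u v = gB p.1 u.1 v.1 + f p.1 ^ 2 * gF p.2 u.2 v.2 := by
  change gB _ (mfderiv (I.prod I') I Prod.fst p u) (mfderiv (I.prod I') I Prod.fst p v)
    + f _ ^ 2 * gF _ (mfderiv (I.prod I') I' Prod.snd p u) (mfderiv (I.prod I') I' Prod.snd p v) = _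
  rw [mfderiv_fst, mfderiv_snd]
  rfl

end ProductCharts

/-! ### Tangent maps of charts and of product charts. -/

section Charts

variable {E : Type*} [NormedAddCommGroup E] [NormedSpace ℝ E] {H : Type*} [TopologicalSpace H]
  {I : ModelWithCorners ℝ E H} [I.Boundaryless] {M : Type*} [TopologicalSpace M] [ChartedSpace H M]
  [IsManifold I ∞ M]

theorem mdifferentiableAt_extend_symm {e : OpenPartialHomeomorph M H} (he : e ∈ atlas H M) {z : E}
    (hz : z ∈ (e.extend I).target) : MDifferentiableAt 𝓘(ℝ, E) I (e.extend I).symm z := by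
  have h := contMDiffOn_extend_symm (IsManifold.subset_maximalAtlas (I := I) (n := ∞) he)
  rw [← e.extend_target'] at h
  exact (h.contMDiffAt ((e.isOpen_extend_target).mem_nhds hz)).mdifferentiableAt (by simp)

/-- The chart composed with its inverse is the identity near `z`, so the derivative has a left
inverse. -/
theorem mfderiv_extend_symm_injective {e : OpenPartialHomeomorph M H} (he : e ∈ atlas H M) {z : E}
    (hz : z ∈ (e.extend I).target) :
    Function.Injective (mfderiv 𝓘(ℝ, E) I (e.extend I).symm z) := by
  have hs : (e.extend I).symm z ∈ e.source := by
    rw [← e.extend_source (I := I)]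
    exact (e.extend I).map_target hz
  have h1 : MDifferentiableAt I 𝓘(ℝ, E) (e.extend I) ((e.extend I).symm z) :=
    (e.contMDiffAt_extend (IsManifold.subset_maximalAtlas (n := ∞) he) hs).mdifferentiableAt
      (by simp)
  have h2 : (e.extend I) ∘ (e.extend I).symm =ᶠ[nhds z] id := by
    filter_upwards [e.isOpen_extend_target.mem_nhds hz] with z' hz'
    exact (e.extend I).right_inv hz'
  intro u v huv
  have h3 := mfderiv_comp_apply z h1 (mdifferentiableAt_extend_symm he hz)
  rw [h2.mfderiv_eq, mfderiv_id] at h3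
  have h4 := h3 u
  rw [huv, ← h3 v] at h4
  exact h4

theorem mfderiv_extend_symm_bijective [FiniteDimensional ℝ E] {e : OpenPartialHomeomorph M H}
    (he : e ∈ atlas H M) {z : E} (hz : z ∈ (e.extend I).target) :
    Function.Bijective (mfderiv 𝓘(ℝ, E) I (e.extend I).symm z) := by
  have h := mfderiv_extend_symm_injective (I := I) he hz
  let T : E →ₗ[ℝ] E := (mfderiv 𝓘(ℝ, E) I (e.extend I).symm z).toLinearMap
  exact ⟨h, LinearMap.injective_iff_surjective (f := T).1 h⟩

theorem IsSemiRiemannian.isLocalMetricAt [FiniteDimensional ℝ E] {g : BilinField I M}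
    (hg : IsSemiRiemannian g) {e : OpenPartialHomeomorph M H} (he : e ∈ atlas H M) {z : E}
    (hz : z ∈ (e.extend I).target) : IsLocalMetricAt (localMetric g e) z := by
  have hev : ∀ᶠ z' in nhds z, z' ∈ (e.extend I).target := e.isOpen_extend_target.mem_nhds hz
  refine ⟨?_, ?_, ?_⟩
  · filter_upwards [hev] with z' h
    exact (hg.smooth e he).contDiffAt (e.isOpen_extend_target.mem_nhds h)
  · filter_upwards [hev] with z' h u v
    exact hg.symm _ _ _
  · filter_upwards [hev] with z' h u hu
    obtain ⟨hinj, hsurj⟩ := mfderiv_extend_symm_bijective (I := I) he h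
    apply hinj
    refine (hg.nondegenerate _ _ fun v => ?_).trans (map_zero _).symm
    obtain ⟨v, rfl⟩ := hsurj v
    exact hu v

variable {E' : Type*} [NormedAddCommGroup E'] [NormedSpace ℝ E'] {H' : Type*} [TopologicalSpace H']
  {I' : ModelWithCorners ℝ E' H'} [I'.Boundaryless] {M' : Type*} [TopologicalSpace M']
  [ChartedSpace H' M'] [IsManifold I' ∞ M']

/-- Both sides differentiate the same map: projecting after the inverse product chart equals
applying the inverse of `e` after projecting. -/
theorem mfderiv_fst_extend_prod {e : OpenPartialHomeomorph M H}
    {e' : OpenPartialHomeomorph M' H'} (he : e ∈ atlas H M) (he' : e' ∈ atlas H' M') {z : E × E'}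
    (hz : z ∈ ((e.prod e').extend (I.prod I')).target) (u : E × E') :
    mfderiv (I.prod I') I Prod.fst (((e.prod e').extend (I.prod I')).symm z)
      (mfderiv 𝓘(ℝ, E × E') (I.prod I') ((e.prod e').extend (I.prod I')).symm z u) =
    mfderiv 𝓘(ℝ, E) I (e.extend I).symm z.1 u.1 := by
  have hz' := hz
  rw [extend_prod_target] at hz'
  have hm : e.prod e' ∈ atlas (ModelProd H H') (M × M') := ⟨e, he, e', he', rfl⟩
  refine (mfderiv_comp_apply (I' := I.prod I') z mdifferentiableAt_fst
    (mdifferentiableAt_extend_symm hm hz) u).symm.trans ?_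
  have h1 := mfderiv_comp_apply (I := 𝓘(ℝ, E × E')) (f := Prod.fst) z
    (mdifferentiableAt_extend_symm (I := I) he hz'.1)
    (differentiableAt_fst (𝕜 := ℝ)).mdifferentiableAt u
  rw [mfderiv_eq_fderiv, fderiv_fst] at h1
  exact h1

theorem mfderiv_snd_extend_prod {e : OpenPartialHomeomorph M H}
    {e' : OpenPartialHomeomorph M' H'} (he : e ∈ atlas H M) (he' : e' ∈ atlas H' M') {z : E × E'}
    (hz : z ∈ ((e.prod e').extend (I.prod I')).target) (u : E × E') :
    mfderiv (I.prod I') I' Prod.snd (((e.prod e').extend (I.prod I')).symm z)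
      (mfderiv 𝓘(ℝ, E × E') (I.prod I') ((e.prod e').extend (I.prod I')).symm z u) =
    mfderiv 𝓘(ℝ, E') I' (e'.extend I').symm z.2 u.2 := by
  have hz' := hz
  rw [extend_prod_target] at hz'
  have hm : e.prod e' ∈ atlas (ModelProd H H') (M × M') := ⟨e, he, e', he', rfl⟩
  refine (mfderiv_comp_apply (I' := I.prod I') z mdifferentiableAt_snd
    (mdifferentiableAt_extend_symm hm hz) u).symm.trans ?_
  have h1 := mfderiv_comp_apply (I := 𝓘(ℝ, E × E')) (f := Prod.snd) z
    (mdifferentiableAt_extend_symm (I := I') he' hz'.2)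
    (differentiableAt_snd (𝕜 := ℝ)).mdifferentiableAt u
  rw [mfderiv_eq_fderiv, fderiv_snd] at h1
  exact h1

/-- The expression of a warped product metric in a product chart. -/
theorem localMetric_warpedProduct (gB : BilinField I M) (f : M → ℝ) (gF : BilinField I' M')
    {e : OpenPartialHomeomorph M H} {e' : OpenPartialHomeomorph M' H'} (he : e ∈ atlas H M)
    (he' : e' ∈ atlas H' M') {z : E × E'} (hz : z ∈ ((e.prod e').extend (I.prod I')).target) :
    localMetric (warpedProduct gB f gF) (e.prod e') z =
      orthogonalSum (localMetric gB e z.1)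
        (f ((e.extend I).symm z.1) ^ 2 • localMetric gF e' z.2) := by
  refine ContinuousLinearMap.ext fun u => ContinuousLinearMap.ext fun v => ?_
  have h1 := mfderiv_fst_extend_prod (I := I) (I' := I') he he' hz
  have h2 := mfderiv_snd_extend_prod (I := I) (I' := I') he he' hz
  set x := (e.extend I).symm z.1
  set y := (e'.extend I').symm z.2
  exact congrArg₂ (fun a b : ℝ => a + f x ^ 2 * b)
    (congrArg₂ (fun a b : TangentSpace I x => gB x a b) (h1 u) (h1 v))
    (congrArg₂ (fun a b : TangentSpace I' y => gF y a b) (h2 u) (h2 v))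

end Charts

/-! ### The base -/

section Base

variable {n : ℕ} {ε α : Fin n → ℝ}

/-- The pseudo-Euclidean metric as a bilinear form on `ℝⁿ`. -/
def pseudoEuclideanForm (ε : Fin n → ℝ) :
    EuclideanSpace ℝ (Fin n) →L[ℝ] EuclideanSpace ℝ (Fin n) →L[ℝ] ℝ :=
  pseudoEuclidean ε (0 : EuclideanSpace ℝ (Fin n))

theorem pseudoEuclideanForm_apply (u v : EuclideanSpace ℝ (Fin n)) :
    pseudoEuclideanForm ε u v = ∑ i, ε i * (u i * v i) :=
  pseudoEuclidean_apply ε 0 u v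

/-- The linear function `ξ` as a continuous linear map. -/
def xiL (α : Fin n → ℝ) : EuclideanSpace ℝ (Fin n) →L[ℝ] ℝ :=
  ∑ i, α i • (EuclideanSpace.proj i : EuclideanSpace ℝ (Fin n) →L[ℝ] ℝ)

theorem xiL_apply (x : EuclideanSpace ℝ (Fin n)) : xiL α x = xi α x := by
  simp [xiL, xi]

theorem isDualVector_pseudoEuclideanForm (hε : ∀ i, ε i = 1 ∨ ε i = -1) (α : Fin n → ℝ) :
    IsDualVector (xiL α) (pseudoEuclideanForm ε) (WithLp.toLp 2 fun i => ε i * α i) where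
  symm u v := by simp only [pseudoEuclideanForm_apply, mul_comm]
  nondegenerate u hu := by
    ext i
    have h := hu (EuclideanSpace.single i 1)
    rw [pseudoEuclideanForm_apply, Finset.sum_eq_single i (by intro j _ hj; simp [hj])
      (by simp)] at h
    rcases hε i with hi | hi <;> simpa [hi] using h
  dual v := by
    rw [pseudoEuclideanForm_apply, xiL_apply, xi]
    refine Finset.sum_congr rfl fun i _ => ?_
    rcases hε i with hi | hi <;> simp [hi]

theorem exists_hasIndex_pseudoEuclideanForm (hε : ∀ i, ε i = 1 ∨ ε i = -1) :
    ∃ ν, HasIndex (pseudoEuclideanForm ε) ν := by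
  -- `X s` consists of the vectors vanishing on the coordinates of sign `s`, so `X 1` is the
  -- negative definite summand and `X (-1)` the positive definite one.
  let X (s : ℝ) : Submodule ℝ (EuclideanSpace ℝ (Fin n)) :=
    { carrier := {u | ∀ i, ε i = s → u i = 0}
      zero_mem' := fun i _ => rfl
      add_mem' := fun {u v} hu hv i hi => by simp [hu i hi, hv i hi]
      smul_mem' := fun t u hu i hi => by simp [hu i hi] }
  have hpos : ∀ u : EuclideanSpace ℝ (Fin n), u ≠ 0 → 0 < ∑ i, u i ^ 2 := by
    intro u hu
    refine lt_of_le_of_ne (Finset.sum_nonneg fun i _ => sq_nonneg _) fun h => hu ?_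
    ext i
    have := (Finset.sum_eq_zero_iff_of_nonneg fun i _ => sq_nonneg (u i)).1 h.symm i
      (Finset.mem_univ i)
    simpa using this
  refine ⟨_, X 1, X (-1), ⟨?_, ?_⟩, rfl, ?_, ?_⟩
  · rw [Submodule.disjoint_def]
    intro u h1 h2
    ext i
    rcases hε i with hi | hi
    · exact h1 i hi
    · exact h2 i hi
  · rw [codisjoint_iff, eq_top_iff]
    intro u _
    refine Submodule.mem_sup.2 ⟨WithLp.toLp 2 fun i => if ε i = 1 then 0 else u i, ?_,
      WithLp.toLp 2 fun i => if ε i = 1 then u i else 0, ?_, ?_⟩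
    · intro i hi
      simp [hi]
    · intro i hi
      have : (-1 : ℝ) ≠ 1 := by norm_num
      simp [hi, this]
    · ext i
      by_cases hi : ε i = 1 <;> simp [hi]
  · intro u hu h0
    rw [pseudoEuclideanForm_apply]
    have : ∑ i, ε i * (u i * u i) = -∑ i, u i ^ 2 := by
      rw [← Finset.sum_neg_distrib]
      refine Finset.sum_congr rfl fun i _ => ?_
      rcases hε i with hi | hi
      · simp [hu i hi]
      · rw [hi]; ring
    rw [this]
    exact neg_neg_of_pos (hpos u h0)
  · intro u hu h0
    rw [pseudoEuclideanForm_apply]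
    have : ∑ i, ε i * (u i * u i) = ∑ i, u i ^ 2 := by
      refine Finset.sum_congr rfl fun i _ => ?_
      rcases hε i with hi | hi
      · rw [hi]; ring
      · simp [hu i hi]
    rw [this]
    exact hpos u h0

theorem domain_nonempty {q c : ℝ} (hq : q ≠ 0) (hα : α ≠ 0) :
    (domain α q c : Set (EuclideanSpace ℝ (Fin n))).Nonempty := by
  obtain ⟨i, hi⟩ : ∃ i, α i ≠ 0 := by
    by_contra! h
    exact hα (funext h)
  -- The point is chosen so that `q ξ + c = 1`.
  refine ⟨EuclideanSpace.single i ((1 - c) / (q * α i)), ?_⟩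
  change 0 < q * xi α _ + c
  have : xi α (EuclideanSpace.single i ((1 - c) / (q * α i))) = (1 - c) / q := by
    rw [xi, Finset.sum_eq_single i (by intro j _ hj; simp [hj]) (by simp)]
    simp
    field_simp
  rw [this]
  field_simp
  simp

theorem mem_domain_iff_of_pos {q c : ℝ} (hq : 0 < q) (x : EuclideanSpace ℝ (Fin n)) :
    x ∈ domain α q c ↔ -(c / q) < xi α x := by
  change 0 < q * xi α x + c ↔ _
  rw [← neg_div, div_lt_iff₀ hq]
  constructor <;> intro h <;> linarith

theorem mem_domain_iff_of_neg {q c : ℝ} (hq : q < 0) (x : EuclideanSpace ℝ (Fin n)) :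
    x ∈ domain α q c ↔ xi α x < -(c / q) := by
  change 0 < q * xi α x + c ↔ _
  rw [← neg_div, lt_div_iff_of_neg hq]
  constructor <;> intro h <;> linarith

variable {Ω : TopologicalSpace.Opens (EuclideanSpace ℝ (Fin n))}

/-- Every chart of an open subset of `ℝⁿ` is a restriction of the identity, so coordinates and
points agree. -/
theorem coe_extend_symm_opens
    {e : OpenPartialHomeomorph Ω (EuclideanSpace ℝ (Fin n))}
    (he : e ∈ atlas (EuclideanSpace ℝ (Fin n)) Ω) {z : EuclideanSpace ℝ (Fin n)}
    (hz : z ∈ (e.extend (𝓡 n)).target) :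
    ((e.extend (𝓡 n)).symm z : EuclideanSpace ℝ (Fin n)) = z := by
  have hz' : z ∈ e.target := by simpa [mfld_simps] using hz
  have hΩ : Nonempty Ω := ⟨(e.extend (𝓡 n)).symm z⟩
  obtain ⟨x, rfl⟩ := TopologicalSpace.Opens.chart_eq hΩ he
  exact OpenPartialHomeomorph.subtypeRestr_symm_apply _ hΩ hz'

theorem mfderiv_coe_extend_symm_opens
    {e : OpenPartialHomeomorph Ω (EuclideanSpace ℝ (Fin n))}
    (he : e ∈ atlas (EuclideanSpace ℝ (Fin n)) Ω) {z : EuclideanSpace ℝ (Fin n)}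
    (hz : z ∈ (e.extend (𝓡 n)).target) (u : EuclideanSpace ℝ (Fin n)) :
    mfderiv (𝓡 n) (𝓡 n) (Subtype.val : Ω → EuclideanSpace ℝ (Fin n)) ((e.extend (𝓡 n)).symm z)
      (mfderiv (𝓡 n) (𝓡 n) (e.extend (𝓡 n)).symm z u) = u := by
  have h1 : MDifferentiableAt (𝓡 n) (𝓡 n) (Subtype.val : Ω → EuclideanSpace ℝ (Fin n))
      ((e.extend (𝓡 n)).symm z) :=
    (contMDiff_subtype_val (n := 1)).mdifferentiable (by simp) _
  have h2 : (Subtype.val : Ω → EuclideanSpace ℝ (Fin n)) ∘ (e.extend (𝓡 n)).symm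
      =ᶠ[nhds z] id := by
    filter_upwards [e.isOpen_extend_target.mem_nhds hz] with z' hz'
    exact coe_extend_symm_opens he hz'
  have h3 := mfderiv_comp_apply (I := 𝓡 n) z h1 (mdifferentiableAt_extend_symm (I := 𝓡 n) he hz) u
  rw [h2.mfderiv_eq, mfderiv_id] at h3
  exact h3.symm

theorem mfderiv_coe_opens_bijective (x : Ω) : Function.Bijective
    (mfderiv (𝓡 n) (𝓡 n) (Subtype.val : Ω → EuclideanSpace ℝ (Fin n)) x) := by
  let e := chartAt (EuclideanSpace ℝ (Fin n)) x
  have he : e ∈ atlas (EuclideanSpace ℝ (Fin n)) Ω := chart_mem_atlas _ x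
  have hz : extChartAt (𝓡 n) x x ∈ (e.extend (𝓡 n)).target := mem_extChartAt_target x
  have hx : (e.extend (𝓡 n)).symm (extChartAt (𝓡 n) x x) = x := extChartAt_to_inv x
  let T : EuclideanSpace ℝ (Fin n) →ₗ[ℝ] EuclideanSpace ℝ (Fin n) :=
    (mfderiv (𝓡 n) (𝓡 n) (Subtype.val : Ω → EuclideanSpace ℝ (Fin n)) x).toLinearMap
  -- The tangent map of the inverse chart is a right inverse; equality of dimensions gives
  -- injectivity.
  have hs : Function.Surjective T := by
    intro u
    have h := mfderiv_coe_extend_symm_opens he hz u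
    rw [hx] at h
    exact ⟨_, h⟩
  have hi : Function.Injective T := LinearMap.injective_iff_surjective.2 hs
  exact ⟨hi, hs⟩

theorem conformalMetric_apply (φ : ℝ → ℝ) (x : Ω) (u v : TangentSpace (𝓡 n) x) :
    conformalMetric ε α φ Ω x u v = 1 / φ (xi α x) ^ 2 *
      pseudoEuclideanForm ε
        (mfderiv (𝓡 n) (𝓡 n) (Subtype.val : Ω → EuclideanSpace ℝ (Fin n)) x u)
        (mfderiv (𝓡 n) (𝓡 n) (Subtype.val : Ω → EuclideanSpace ℝ (Fin n)) x v) := rfl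

theorem localMetric_conformalMetric (φ : ℝ → ℝ)
    {e : OpenPartialHomeomorph Ω (EuclideanSpace ℝ (Fin n))}
    (he : e ∈ atlas (EuclideanSpace ℝ (Fin n)) Ω) {z : EuclideanSpace ℝ (Fin n)}
    (hz : z ∈ (e.extend (𝓡 n)).target) :
    localMetric (conformalMetric ε α φ Ω) e z
      = (1 / φ (xiL α z) ^ 2) • pseudoEuclideanForm ε := by
  refine ContinuousLinearMap.ext fun u => ContinuousLinearMap.ext fun v => ?_
  have h1 := coe_extend_symm_opens he hz
  have hu := mfderiv_coe_extend_symm_opens he hz u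
  have hv := mfderiv_coe_extend_symm_opens he hz v
  have h2 := conformalMetric_apply (ε := ε) (α := α) φ ((e.extend (𝓡 n)).symm z)
    (mfderiv (𝓡 n) (𝓡 n) (e.extend (𝓡 n)).symm z u)
    (mfderiv (𝓡 n) (𝓡 n) (e.extend (𝓡 n)).symm z v)
  rw [localMetric_apply]
  refine h2.trans ?_
  rw [smul_apply, smul_apply, smul_eq_mul, xiL_apply]
  exact congrArg₂ (· * ·) (congrArg (fun y => 1 / φ (xi α y) ^ 2) h1)
    (congrArg₂ (fun a b : EuclideanSpace ℝ (Fin n) => pseudoEuclideanForm ε a b) hu hv)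

end Base

/-! ### The warped product -/

section WarpedProduct

variable {n m : ℕ} {ε α : Fin n → ℝ} {Ω : TopologicalSpace.Opens (EuclideanSpace ℝ (Fin n))}

theorem conformalMetric_symm (hε : ∀ i, ε i = 1 ∨ ε i = -1) (φ : ℝ → ℝ) (x : Ω)
    (u v : TangentSpace (𝓡 n) x) :
    conformalMetric ε α φ Ω x u v = conformalMetric ε α φ Ω x v u := by
  rw [conformalMetric_apply, conformalMetric_apply]
  exact congrArg _ ((isDualVector_pseudoEuclideanForm hε α).symm _ _)

theorem conformalMetric_nondegenerate (hε : ∀ i, ε i = 1 ∨ ε i = -1) {φ : ℝ → ℝ} {x : Ω}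
    (hφ : φ (xi α x) ≠ 0) (u : TangentSpace (𝓡 n) x)
    (hu : ∀ v, conformalMetric ε α φ Ω x u v = 0) : u = 0 := by
  obtain ⟨hinj, hsurj⟩ := mfderiv_coe_opens_bijective x
  refine hinj (((isDualVector_pseudoEuclideanForm hε α).nondegenerate _ fun v => ?_).trans
    (map_zero _).symm)
  obtain ⟨v, rfl⟩ := hsurj v
  have h := hu v
  rw [conformalMetric_apply] at h
  exact (mul_eq_zero.1 h).resolve_left (one_div_ne_zero (pow_ne_zero 2 hφ))

theorem conformalMetric_hasIndex {φ : ℝ → ℝ} {ν : ℕ} (hν : HasIndex (pseudoEuclideanForm ε) ν)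
    {x : Ω} (hφ : φ (xi α x) ≠ 0) : HasIndex (conformalMetric ε α φ Ω x) ν := by
  have ht : 0 < 1 / φ (xi α x) ^ 2 := by positivity
  let L := LinearEquiv.ofBijective
    (mfderiv (𝓡 n) (𝓡 n) (Subtype.val : Ω → EuclideanSpace ℝ (Fin n)) x).toLinearMap
    (mfderiv_coe_opens_bijective x)
  have h : HasIndex ((1 / φ (xi α x) ^ 2) • pseudoEuclideanForm ε) ν :=
    hν.smul ht fun _ _ => rfl
  exact h.of_equiv L fun u v => conformalMetric_apply φ x u v

variable {F : Type*} [TopologicalSpace F] [ChartedSpace (EuclideanSpace ℝ (Fin m)) F]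

theorem contMDiff_comp_xi {h : ℝ → ℝ} (hh : ∀ x ∈ Ω, ContDiffAt ℝ ∞ h (xi α x)) :
    ContMDiff ((𝓡 n).prod (𝓡 m)) 𝓘(ℝ, ℝ) ∞ fun p : Ω × F => h (xi α p.1) := by
  have h1 : ContMDiff ((𝓡 n).prod (𝓡 m)) 𝓘(ℝ, ℝ) ∞ fun p : Ω × F => xiL α p.1 :=
    (xiL α).contDiff.contMDiff.comp (contMDiff_subtype_val.comp contMDiff_fst)
  simp only [← xiL_apply] at hh ⊢
  exact fun p => (hh _ p.1.2).contMDiffAt.comp p (h1 p)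

variable [IsManifold (𝓡 m) ∞ F] {gF : BilinField (𝓡 m) F}

theorem localMetric_warpedProduct_conformalMetric (φ f : ℝ → ℝ)
    {e : OpenPartialHomeomorph Ω (EuclideanSpace ℝ (Fin n))}
    {e' : OpenPartialHomeomorph F (EuclideanSpace ℝ (Fin m))}
    (he : e ∈ atlas (EuclideanSpace ℝ (Fin n)) Ω) (he' : e' ∈ atlas (EuclideanSpace ℝ (Fin m)) F)
    {z : EuclideanSpace ℝ (Fin n) × EuclideanSpace ℝ (Fin m)}
    (hz : z ∈ ((e.prod e').extend ((𝓡 n).prod (𝓡 m))).target) :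
    localMetric (warpedProduct (conformalMetric ε α φ Ω) (fun x => f (xi α x)) gF) (e.prod e') z =
      warpedMetric (xiL α) (fun t => 1 / φ t ^ 2) (fun t => f t ^ 2) (pseudoEuclideanForm ε)
        (localMetric gF e') z := by
  rw [localMetric_warpedProduct _ _ _ he he' hz]
  rw [extend_prod_target] at hz
  rw [localMetric_conformalMetric φ he hz.1, coe_extend_symm_opens he hz.1, ← xiL_apply]
  rfl

theorem isSemiRiemannian_warpedProduct (hε : ∀ i, ε i = 1 ∨ ε i = -1) {φ f : ℝ → ℝ}
    (hφ : ∀ x ∈ Ω, φ (xi α x) ≠ 0) (hf : ∀ x ∈ Ω, f (xi α x) ≠ 0)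
    (hφ' : ∀ x ∈ Ω, ContDiffAt ℝ ∞ φ (xi α x)) (hf' : ∀ x ∈ Ω, ContDiffAt ℝ ∞ f (xi α x))
    (hF : IsSemiRiemannian gF) :
    IsSemiRiemannian (warpedProduct (conformalMetric ε α φ Ω) (fun x => f (xi α x)) gF) where
  symm p u v := by
    rw [warpedProduct_apply, warpedProduct_apply]
    exact congrArg₂ (fun a b : ℝ => a + f (xi α p.1) ^ 2 * b)
      (conformalMetric_symm hε φ p.1 u.1 v.1) (hF.symm p.2 u.2 v.2)
  nondegenerate p u hu := by
    have h1 : u.1 = 0 := conformalMetric_nondegenerate hε (hφ _ p.1.2) _ fun v => by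
      have h : conformalMetric ε α φ Ω p.1 u.1 v
          + f (xi α p.1) ^ 2 * gF p.2 u.2 (0 : TangentSpace (𝓡 m) p.2) = 0 :=
        (warpedProduct_apply _ _ _ p u (v, 0)).symm.trans (hu (v, 0))
      rwa [map_zero (gF p.2 u.2), mul_zero, add_zero] at h
    have h2 : u.2 = 0 := hF.nondegenerate p.2 _ fun v => by
      have h : conformalMetric ε α φ Ω p.1 u.1 (0 : TangentSpace (𝓡 n) p.1)
          + f (xi α p.1) ^ 2 * gF p.2 u.2 v = 0 :=
        (warpedProduct_apply _ _ _ p u (0, v)).symm.trans (hu (0, v))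
      rw [map_zero (conformalMetric ε α φ Ω p.1 u.1), zero_add] at h
      exact (mul_eq_zero.1 h).resolve_left (pow_ne_zero 2 (hf _ p.1.2))
    exact Prod.ext h1 h2
  index := by
    obtain ⟨ν, hν⟩ := exists_hasIndex_pseudoEuclideanForm hε
    obtain ⟨μ, hμ⟩ := hF.index
    refine ⟨ν + μ, fun p => ?_⟩
    have hpos : 0 < f (xi α p.1) ^ 2 := by
      have := hf _ p.1.2
      positivity
    let β : EuclideanSpace ℝ (Fin n) →L[ℝ] EuclideanSpace ℝ (Fin n) →L[ℝ] ℝ :=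
      conformalMetric ε α φ Ω p.1
    let γ : EuclideanSpace ℝ (Fin m) →L[ℝ] EuclideanSpace ℝ (Fin m) →L[ℝ] ℝ := gF p.2
    let δ : EuclideanSpace ℝ (Fin n) × EuclideanSpace ℝ (Fin m) →L[ℝ]
        EuclideanSpace ℝ (Fin n) × EuclideanSpace ℝ (Fin m) →L[ℝ] ℝ :=
      warpedProduct (conformalMetric ε α φ Ω) (fun x => f (xi α x)) gF p
    have hβ : HasIndex β ν := conformalMetric_hasIndex hν (hφ _ p.1.2)
    have hγ : HasIndex γ μ := hμ p.2
    have hγ' : HasIndex (f (xi α p.1) ^ 2 • γ) μ := hγ.smul hpos fun _ _ => rfl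
    have hδ : HasIndex δ (ν + μ) := hβ.prod hγ' fun u v => warpedProduct_apply _ _ _ p u v
    exact hδ
  smooth := by
    -- The atlas of the product consists exactly of the products of charts.
    rintro _ ⟨e, he, e', he', rfl⟩
    refine ContDiffOn.congr (fun z hz => ContDiffAt.contDiffWithinAt ?_)
      fun z hz => localMetric_warpedProduct_conformalMetric φ f he he' hz
    rw [extend_prod_target] at hz
    have hmem : z.1 ∈ Ω := by
      rw [← coe_extend_symm_opens he hz.1]
      exact ((e.extend (𝓡 n)).symm z.1).2
    have h1 := hφ _ hmem
    have h2 := hφ' _ hmem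
    have h3 := hf' _ hmem
    rw [← xiL_apply] at h1 h2 h3
    exact contDiffAt_warpedMetric (contDiffAt_const.div (h2.pow 2) (pow_ne_zero 2 h1)) (h3.pow 2)
      ((hF.smooth e' he').contDiffAt (e'.isOpen_extend_target.mem_nhds hz.2))

theorem isQuasiEinstein_warpedProduct {k c₁ c₂ c₃ c r q N : ℝ} (hε : ∀ i, ε i = 1 ∨ ε i = -1)
    (hc₁ : 0 < c₁) (hc₂ : 0 < c₂) (hc₃ : 0 < c₃) (hq : q = coeffA n m k - r * N) (hq0 : q ≠ 0)
    (hN : r * (r - 1) * N ^ 2 - 2 * r * (k + coeffA n m k) * N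
      + coeffA n m k ^ 2 - coeffB n m k = 0) (hF : IsRicciFlat gF) :
    IsQuasiEinstein
      (warpedProduct (conformalMetric ε α (powerLaw c₃ q c k) (domain α q c))
        (fun x => powerLaw c₁ q c 1 (xi α x)) gF)
      (fun p : domain α q c × F => powerLaw c₂ q c N (xi α p.1)) r 0 where
  semiRiemannian := isSemiRiemannian_warpedProduct hε
    (fun _ hx => (powerLaw_pos hc₃ hx).ne') (fun _ hx => (powerLaw_pos hc₁ hx).ne')
    (fun _ hx => contDiffAt_powerLaw _ _ hx) (fun _ hx => contDiffAt_powerLaw _ _ hx)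
    hF.semiRiemannian
  smooth := contMDiff_comp_xi fun _ hx => contDiffAt_powerLaw _ _ hx
  pos p := powerLaw_pos hc₂ p.1.2
  equation := by
    rintro _ ⟨e, he, e', he', rfl⟩ z hz u v
    have hz' := hz
    rw [extend_prod_target] at hz'
    have hnhds : ∀ᶠ z' in nhds z, z' ∈ ((e.prod e').extend ((𝓡 n).prod (𝓡 m))).target := by
      rw [extend_prod_target]
      exact (e.isOpen_extend_target.prod e'.isOpen_extend_target).mem_nhds hz'
    -- Ricci tensor and Hessian depend on germs, hence equality is needed on a neighbourhood and not
    -- only at `z`.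
    have hG := hnhds.mono fun z' h => localMetric_warpedProduct_conformalMetric (gF := gF)
      (ε := ε) (α := α) (powerLaw c₃ q c k) (powerLaw c₁ q c 1) he he' h
    have hval : ∀ z' ∈ ((e.prod e').extend ((𝓡 n).prod (𝓡 m))).target,
        powerLaw c₂ q c N (xi α (((e.prod e').extend ((𝓡 n).prod (𝓡 m))).symm z').1)
          = powerLaw c₂ q c N (xiL α z'.1) := by
      intro z' h
      rw [extend_prod_target] at h
      rw [xiL_apply]
      exact congrArg (fun x => powerLaw c₂ q c N (xi α x)) (coe_extend_symm_opens he h.1)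
    have hmem : z.1 ∈ domain α q c := by
      rw [← coe_extend_symm_opens he hz'.1]
      exact ((e.extend (𝓡 n)).symm z.1).2
    have hpos : 0 < q * xiL α z.1 + c := by
      rw [xiL_apply]
      exact hmem
    have hh := hnhds.mono hval
    change _ - r / powerLaw c₂ q c N (xi α (((e.prod e').extend ((𝓡 n).prod (𝓡 m))).symm z).1)
      * hessian _ (fun z' =>
        powerLaw c₂ q c N (xi α (((e.prod e').extend ((𝓡 n).prod (𝓡 m))).symm z').1)) z u v = _
    rw [ricci_congr hG, hessian_congr hG hh, hval z hz, zero_mul]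
    exact ricci_sub_hessian_powerLaw (by simp) (by simp) hq hq0 hN hc₁ hc₂ hc₃
      (isDualVector_pseudoEuclideanForm hε α) (hF.semiRiemannian.isLocalMetricAt he' hz'.2)
      (hF.ricci_eq e' he' z.2 hz'.2) hpos u v

end WarpedProduct

end QuasiEinstein

end

open QuasiEinstein in
theorem mainTheorem6 {n m : ℕ} (hn : 3 ≤ n) (hm : 1 ≤ m)
    (ε α : Fin n → ℝ) (hε : ∀ i, ε i = 1 ∨ ε i = -1)
    (i₀ : Fin n) (hα : ∑ i, ε i * α i ^ 2 = ε i₀)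
    (k c₁ c₂ c₃ c r : ℝ) (hk : 0 < k) (hc₁ : 0 < c₁) (hc₂ : 0 < c₂) (hc₃ : 0 < c₃)
    (hr : 0 < r) (hr1 : r ≠ 1)
    (hdisc : (r - 1) * (coeffA n m k ^ 2 - coeffB n m k) ≤ r * (k + coeffA n m k) ^ 2)
    {F : Type*} [TopologicalSpace F] [ChartedSpace (EuclideanSpace ℝ (Fin m)) F]
    [IsManifold (𝓡 m) ∞ F] (gF : BilinField (𝓡 m) F) (hF : IsRicciFlat gF) :
    -- the numbers `N_±` are exactly the roots of the quadratic equation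
    (∀ N : ℝ, r * (r - 1) * N ^ 2 - 2 * r * (k + coeffA n m k) * N
        + coeffA n m k ^ 2 - coeffB n m k = 0 ↔ N = rootN n m k r 1 ∨ N = rootN n m k r (-1)) ∧
    -- for each choice of the sign `s = ±1`, with `N = N_±` and `q = a - r N_±`
    ∀ s N q : ℝ, (s = 1 ∨ s = -1) → N = rootN n m k r s → q = coeffA n m k - r * N →
      -- the domain is an open half-space
      q ≠ 0 ∧
      (0 < q → ∀ x, x ∈ domain α q c ↔ -(c / q) < xi α x) ∧
      (q < 0 → ∀ x, x ∈ domain α q c ↔ xi α x < -(c / q)) ∧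
      (domain α q c : Set (EuclideanSpace ℝ (Fin n))).Nonempty ∧
      -- the functions are smooth and positive there, and they solve the reduced system
      (∀ t : ℝ, 0 < q * t + c →
        ContDiffAt ℝ ∞ (powerLaw c₁ q c 1) t ∧ ContDiffAt ℝ ∞ (powerLaw c₂ q c N) t ∧
        ContDiffAt ℝ ∞ (powerLaw c₃ q c k) t ∧
        0 < powerLaw c₁ q c 1 t ∧ 0 < powerLaw c₂ q c N t ∧ 0 < powerLaw c₃ q c k t ∧
        ReducedSystem n m r (ε i₀) 0 0 (powerLaw c₁ q c 1) (powerLaw c₂ q c N)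
          (powerLaw c₃ q c k) t) ∧
      -- the warped product is quasi-Einstein with `ρ = 0`
      IsQuasiEinstein
        (warpedProduct (conformalMetric ε α (powerLaw c₃ q c k) (domain α q c))
          (fun x => powerLaw c₁ q c 1 (xi α x)) gF)
        (fun p : domain α q c × F => powerLaw c₂ q c N (xi α p.1)) r 0 := by
  have hquad := quadratic_iff_rootN (n := n) (m := m) (k := k) hr hr1 hdisc
  refine ⟨hquad, fun s N q hs hNs hq => ?_⟩
  have hN := (hquad N).2 (by rcases hs with rfl | rfl <;> simp [hNs])
  have hq0 := ne_zero_of_quadratic hn hk hr hq hN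
  -- For `α = 0` the normalisation would force `ε i₀ = 0`.
  have hα0 : α ≠ 0 := by
    rintro rfl
    rcases hε i₀ with h | h <;> simp [h] at hα
  exact ⟨hq0, mem_domain_iff_of_pos, mem_domain_iff_of_neg, domain_nonempty hq0 hα0,
    fun t ht => ⟨contDiffAt_powerLaw _ _ ht, contDiffAt_powerLaw _ _ ht, contDiffAt_powerLaw _ _ ht,
      powerLaw_pos hc₁ ht, powerLaw_pos hc₂ ht, powerLaw_pos hc₃ ht,
      reducedSystem_powerLaw hq hq0 hN _ _ _ _ ht⟩,
    isQuasiEinstein_warpedProduct hε hc₁ hc₂ hc₃ hq hq0 hN hF⟩
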